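/- **Setting.** Let $V=\{0,\dots,p\}\times\{1,\dots,d\}$; node $(k,l)$ carries the real variable $N_{k,l}$, the $k$ time-lagged version of the $l$-th of $d$ measuring points. An interventional family is $\mathcal I=(I_1,\dots,I_Q)$ with $I_q\subseteq V$, $Q\ge 1$; put $|\mathcal I|=\sum_q|I_q|$. For a DAG $\mathcal G$ on $V$ let $|\mathcal G|$ be its number of edges, $\pi_j^{\mathcal G}$ the parents of $j$, and let $\mathcal M_{\mathcal I}(\mathcal G)$ be the set of families $(p^{(q)})_{q\le Q}$ of strictly positive Lebesgue densities on $\mathbb R^V$ of the form (almost everywhere) $$p^{(q)}(x)=\prod_{j\notin I_q}p_j^{(1)}(x_j\mid x_{\pi_j^{\mathcal G}})\prod_{j\in I_q}p_j^{(q)}(x_j\mid x_{\pi_j^{\mathcal G}})$$ with strictly positive conditional densities $p_j^{(q)}$. Two DAGs $\mathcal G_1,\mathcal G_2$ are $\mathcal I$-Markov equivalent if $\mathcal M_{\mathcal I}(\mathcal G_1)=\mathcal M_{\mathcal I}(\mathcal G_2)$. **Model.** Let $\tilde f(\cdot\,;\theta)$ be a measurable parametric family of probability densities on $\mathbb R$,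 and for each $j$ let $\mathrm{NN}_j(\cdot\,;w)$ be a parametrized family of measurable maps (e.g. neural networks) from $\mathbb R^V$ to the set of parameters $\theta$. For weights $\phi=(\phi_j^{(q)})$ put $$f^{(q)}(x;\mathcal G,\mathcal I,\phi)=\prod_{j\notin I_q}\tilde f\big(x_j;\mathrm{NN}_j(M_j^{\mathcal G}\odot x;\phi_j^{(1)})\big)\prod_{j\in I_q}\tilde f\big(x_j;\mathrm{NN}_j(M_j^{\mathcal G}\odot x;\phi_j^{(q)})\big),$$ where $M_j^{\mathcal G}\odot x$ is $x$ with the entries outside $\pi_j^{\mathcal G}$ set to $0$. For densities $p^{(1)},\dots,p^{(Q)}$ on $\mathbb R^V$ and $\lambda,\lambda_R>0$ the score, with values in $[-\infty,\infty]$, is $$\mathcal S(\mathcal G,\mathcal I)=\sup_\phi\sum_{q=1}^Q\mathbb E_{X\sim p^{(q)}}\log f^{(q)}(X;\mathcal G,\mathcal I,\phi)-\lambda|\mathcal G|-\lambda_R|\mathcal I|.$$ **Theorem.** Let $\mathcal G^*$ be a DAG on $V$, $\mathcal I^*=(I_1^*,\dots,I_Q^*)$ an interventional family with $I_1^*=\emptyset$,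 and $(p^{(q)})_{q\le Q}\in\mathcal M_{\mathcal I^*}(\mathcal G^*)$ (the ground truth). Assume: 1. (capacity) there is $\phi$ such that $p^{(q)}=f^{(q)}(\cdot\,;\mathcal G^*,\mathcal I^*,\phi)$ a.e. for all $q$; 2. ($\mathcal I^*$-faithfulness) (a) for pairwise disjoint $A,B,C\subseteq V$, if $A,B$ are not d-separated by $C$ in $\mathcal G^*$, then $X_A,X_B$ are not conditionally independent given $X_C$ under $p^{(1)}$; (b) let $\mathcal G^{*\mathcal I^*}$ be $\mathcal G^*$ with an added vertex $\zeta_k$ for each $2\le k\le Q$ and edges $\zeta_k\to j$ for all $j\in I_k^*$; for disjoint $A,C\subseteq V$ and $2\le k\le Q$, if $A$ and $\zeta_k$ are not d-separated by $C\cup\{\zeta_l:l\ne k\}$ in $\mathcal G^{*\mathcal I^*}$, then the conditional laws $p^{(1)}(x_A\mid x_C)$ and $p^{(k)}(x_A\mid x_C)$ are not almost everywhere equal; 3. (positivity) $f^{(q)}(x;\mathcal G,\mathcal I,\phi)>0$ for all DAGs $\mathcal G$ and all $\mathcal I,\phi,q,x$; 4. (finite entropy) $\int|p^{(q)}\log p^{(q)}|\,dx<\infty$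 for all $q$. Then there is $\lambda_0>0$ such that for all $\lambda,\lambda_R\in(0,\lambda_0)$ the following holds. Let $\mathfrak S$ be any set of pairs (DAG on $V$, interventional family) that contains $(\mathcal G^*,\mathcal I^*)$: for instance all such pairs, or, if $(\mathcal G^*,\mathcal I^*)$ is of this kind, those whose DAG is temporal (no edge from a later to an earlier time) and whose targets are contemporaneous variables $N_{0,l}$. If $(\hat{\mathcal G},\hat{\mathcal I})$ maximizes $\mathcal S$ over $\mathfrak S$, then $\hat{\mathcal G}$ is $\mathcal I^*$-Markov equivalent to $\mathcal G^*$ and $\hat{\mathcal I}=\mathcal I^*$. -/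

import Mathlib

open MeasureTheory ProbabilityTheory
open scoped ENNReal

namespace TemporalCausal

/-- The time-indexed variables `N_{k,l}`: the node `(k, l)` is the `k` time-lagged version of the
`l`-th of `d` measuring points, `0 ≤ k ≤ p`. The contemporaneous variables are the `(0, l)`. -/
abbrev Node (d p : ℕ) : Type := Fin (p + 1) × Fin d

/-- An interventional family `(I_0, …, I_K)`: one set of intervened nodes per regime. Regime `0` is
the observational one (it is the first regime, written `I_1` when counting from one). -/
abbrev InterventionFamily (V : Type*) (K : ℕ) : Type _ := Fin (K + 1) → Finset V

section Graphs

variable {V : Type*}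

/-- A directed graph is a DAG if it has no directed cycle (in particular no loop). -/
def IsDAG (G : Digraph V) : Prop := ∀ v, ¬ Relation.TransGen G.Adj v v

/-- `|G|`, the number of edges. -/
noncomputable def edgeCount (G : Digraph V) : ℕ := Set.ncard {e : V × V | G.Adj e.1 e.2}

/-- `|I|`, the total number of intervened nodes over all regimes. -/
def targetCount {K : ℕ} (I : InterventionFamily V K) : ℕ := ∑ q, (I q).card

/-- A path of the underlying undirected graph: distinct vertices, consecutive ones adjacent. -/
def IsPath (G : Digraph V) (l : List V) : Prop :=
  l.Nodup ∧ l.IsChain (fun a b => G.Adj a b ∨ G.Adj b a)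

/-- A path is active given `C` if every collider on it is an ancestor of (or in) `C`, and no
inner non-collider is in `C`. -/
def IsActive (G : Digraph V) (C : Set V) (l : List V) : Prop :=
  ∀ a b c, [a, b, c] <:+: l →
    ((G.Adj a b ∧ G.Adj c b) → ∃ e ∈ C, Relation.ReflTransGen G.Adj b e) ∧
    (¬ (G.Adj a b ∧ G.Adj c b) → b ∉ C)

/-- `A` and `B` are d-separated by `C` (for pairwise disjoint `A`, `B`, `C`): no path between them
is active given `C`. -/
def DSep (G : Digraph V) (A B C : Set V) : Prop :=
  ∀ a ∈ A, ∀ b ∈ B, ∀ l : List V,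
    l.head? = some a → l.getLast? = some b → IsPath G l → ¬ IsActive G C l

/-- The graph `G^I`: a new vertex `ζ_k` is added for each non-observational regime `k + 1`, with
an edge to each node that is intervened in this regime. -/
def augmented {K : ℕ} (G : Digraph V) (I : InterventionFamily V K) : Digraph (V ⊕ Fin K) where
  Adj
    | .inl i, .inl j => G.Adj i j
    | .inr k, .inl j => j ∈ I k.succ
    | _, .inr _ => False

end Graphs

section Densities

variable {V : Type*} [Fintype V]

/-- A probability density on `ℝ^V` with respect to Lebesgue measure. -/
structure JointDensity (V : Type*) [Fintype V] where
  toFun : (V → ℝ) → ℝ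
  measurable : Measurable toFun
  nonneg : ∀ x, 0 ≤ toFun x
  lintegral_eq_one : ∫⁻ x, ENNReal.ofReal (toFun x) = 1

/-- The distribution with the given density. -/
noncomputable def JointDensity.law (p : JointDensity V) : Measure (V → ℝ) :=
  volume.withDensity (fun x => ENNReal.ofReal (p.toFun x))

instance (p : JointDensity V) : IsProbabilityMeasure p.law :=
  ⟨by simp [JointDensity.law, p.lintegral_eq_one]⟩

/-- Finite differential entropy: `∫ |p log p| < ∞`. -/
def JointDensity.HasFiniteEntropy (p : JointDensity V) : Prop :=
  Integrable (fun x => p.toFun x * Real.log (p.toFun x)) volume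

/-- `c x y` is a strictly positive conditional density of `x_j = y` given the parents of `j`:
it depends on `x` only through the coordinates that are parents of `j`. -/
structure IsCondDensity (G : Digraph V) (j : V) (c : (V → ℝ) → ℝ → ℝ) : Prop where
  measurable : Measurable (Function.uncurry c)
  pos : ∀ x y, 0 < c x y
  lintegral_eq_one : ∀ x, ∫⁻ y, ENNReal.ofReal (c x y) = 1
  parents : ∀ x x' : V → ℝ, (∀ i, G.Adj i j → x i = x' i) → c x = c x'

open Classical in
/-- The set `M_I(G)` of families of strictly positive joint densities
`p^{(q)}(x) = ∏_{j ∉ I_q} p_j^{(0)}(x_j | x_{pa(j)}) ∏_{j ∈ I_q} p_j^{(q)}(x_j | x_{pa(j)})`.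
As densities are determined up to null sets only, the equation is required almost everywhere. -/
def markovFamilies {K : ℕ} (I : InterventionFamily V K) (G : Digraph V) :
    Set (Fin (K + 1) → JointDensity V) :=
  {p | ∃ c : Fin (K + 1) → V → (V → ℝ) → ℝ → ℝ,
    (∀ q j, IsCondDensity G j (c q j)) ∧
    ∀ q, (p q).toFun =ᵐ[volume] fun x => ∏ j, c (if j ∈ I q then q else 0) j x (x j)}

/-- `I`-Markov equivalence: the two graphs allow the same families of interventional densities. -/
def IMarkovEquiv {K : ℕ} (I : InterventionFamily V K) (G H : Digraph V) : Prop :=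
  markovFamilies I G = markovFamilies I H

/-- `X_A ⊥ X_B | X_C` under the density `p`. -/
def CondIndepVars (p : JointDensity V) (A B C : Set V) : Prop :=
  CondIndepFun (MeasurableSpace.comap (C.domRestrict (π := fun _ => ℝ)) inferInstance)
    (measurable_pi_lambda (C.domRestrict (π := fun _ => ℝ)) fun i => measurable_pi_apply i.1).comap_le
    (A.domRestrict (π := fun _ => ℝ)) (B.domRestrict (π := fun _ => ℝ)) p.law

/-- `p(x_A | x_C) = p'(x_A | x_C)` (almost everywhere). -/
def SameConditional (p p' : JointDensity V) (A C : Set V) : Prop :=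
  condDistrib (A.domRestrict (π := fun _ => ℝ)) (C.domRestrict (π := fun _ => ℝ)) p.law
    =ᵐ[p.law.map (C.domRestrict (π := fun _ => ℝ))]
  condDistrib (A.domRestrict (π := fun _ => ℝ)) (C.domRestrict (π := fun _ => ℝ)) p'.law

/-- `I`-faithfulness: the conditional independences of the observational density, and the
invariances of conditional densities between the observational and an interventional regime, are
only those which d-separation in `G` and in the augmented graph `G^I` accounts for. -/
structure IFaithful {K : ℕ} (p : Fin (K + 1) → JointDensity V) (G : Digraph V)
    (I : InterventionFamily V K) : Prop where
  indep : ∀ A B C : Set V, Disjoint A B → Disjoint A C → Disjoint B C →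
    ¬ DSep G A B C → ¬ CondIndepVars (p 0) A B C
  invariance : ∀ (A C : Set V) (k : Fin K), Disjoint A C →
    ¬ DSep (augmented G I) (Sum.inl '' A) {Sum.inr k} (Sum.inl '' C ∪ Sum.inr '' {k}ᶜ) →
    ¬ SameConditional (p 0) (p k.succ) A C

end Densities

section Model

variable {V : Type*} [Fintype V]

/-- A parametric model of the conditional densities: a family `dens θ` of univariate densities and,
for each node `j`, a network `net j` with weights in `Φ j` that maps a (masked) input vector to a
density parameter `θ`. Architecture and parametric family are arbitrary. -/
structure DensityModel (V : Type*) (Θ : Type*) [MeasurableSpace Θ] (Φ : V → Type*) where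
  dens : Θ → ℝ → ℝ
  measurable_dens : Measurable (Function.uncurry dens)
  dens_nonneg : ∀ θ y, 0 ≤ dens θ y
  lintegral_dens : ∀ θ, ∫⁻ y, ENNReal.ofReal (dens θ y) = 1
  net : ∀ j, Φ j → (V → ℝ) → Θ
  measurable_net : ∀ j w, Measurable (net j w)

open Classical in
/-- `M_j^G ⊙ x`: the entries of `x` that are not parents of `j` are set to zero. -/
noncomputable def mask (G : Digraph V) (j : V) (x : V → ℝ) : V → ℝ :=
  fun i => if G.Adj i j then x i else 0

variable {Θ : Type*} [MeasurableSpace Θ] {Φ : V → Type*} {K : ℕ}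

open Classical in
/-- The model density `f^{(q)}(x; M^G, R^I, φ)`; the factor of node `j` uses the weights `φ^{(q)}_j`
if `j ∈ I_q`, and the observational weights `φ^{(0)}_j` otherwise. -/
noncomputable def DensityModel.joint (m : DensityModel V Θ Φ) (G : Digraph V)
    (I : InterventionFamily V K) (φ : Fin (K + 1) → ∀ j, Φ j) (q : Fin (K + 1)) (x : V → ℝ) : ℝ :=
  ∏ j, m.dens (m.net j (φ (if j ∈ I q then q else 0) j) (mask G j x)) (x j)

/-- The expectation `E_μ[g]` as an extended real number, `E_μ[g⁺] - E_μ[g⁻]`. -/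
noncomputable def expectation (μ : Measure (V → ℝ)) (g : (V → ℝ) → ℝ) : EReal :=
  ((∫⁻ x, ENNReal.ofReal (g x) ∂μ : ℝ≥0∞) : EReal)
    - ((∫⁻ x, ENNReal.ofReal (-g x) ∂μ : ℝ≥0∞) : EReal)

/-- The score
`S(G, I) = sup_φ ∑_q E_{X ∼ p^{(q)}} log f^{(q)}(X; M^G, R^I, φ) - lam |G| - lamR |I|`. -/
noncomputable def score (m : DensityModel V Θ Φ) (p : Fin (K + 1) → JointDensity V)
    (lam lamR : ℝ) (G : Digraph V) (I : InterventionFamily V K) : EReal :=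
  (⨆ φ : Fin (K + 1) → ∀ j, Φ j,
      ∑ q, expectation (p q).law (fun x => Real.log (m.joint G I φ q x)))
    - ((lam * edgeCount G : ℝ) : EReal) - ((lamR * targetCount I : ℝ) : EReal)

end Model

end TemporalCausal

open TemporalCausal

/-!
The score of a candidate `(G, I)` is, up to the constant `∑ q, ∫ p q log p q` and the penalties,
minus the infimum of the total Kullback-Leibler divergence of the true densities `p` from the densities that
the model can represent with `(G, I)`. The ground truth has divergence zero, so a maximizer has a
divergence of at most `lam |G*| + lamR |I*|`. There are only finitely many candidates; hence, for
small penalties, the infimum of the divergence over the weights is zero for every maximizer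
(`DensityModel.IsPositive.iSup_le`). By a Pinsker type inequality (`abs_sub_le_of_log`) the densities
`p` are then limits in `L¹` of families that factorize according to `(G, I)`; the infimum need not be
attained, so this is all that is known (`IsApproximable`).

Such limits inherit two consequences of the factorization: in the observational regime a node is
independent of each non-descendant given its parents, and its conditional law given its parents is
unchanged in the regimes that do not target it. Indeed, the integrals of the test functions
`g (1_B(x_j) - H)`, where `g` is a function of non-descendants and `H` the conditional probability of
`B` given the parents, vanish for the approximating densities
(`lintegral_indicator_mul_productDensity`), hence are small under `p`, uniformly in `g`. This
determines the conditional distributions, although `H` varies with the approximation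
(`condDistrib_prod_ae_eq_of_approx`, `condDistrib_ae_eq_of_common_approx`). By faithfulness,
the corresponding d-separations hold in the true graph (`IsApproximable.separates`).

Applied to paths with one or two edges, these separations show that all adjacencies of `G*` are
adjacencies of `G`, and that the true targets are contained in `I`. As `(G, I)` is not penalized more
than `(G*, I*)`, the skeletons and the targets are equal, and then the same separations give equal
v-structures in the augmented graphs (`Separates.graphEquiv`). Finally, two such graphs are connected
by reversals of covered edges whose ends belong to the same targets
(`GraphEquiv.exists_isCovered`), and such a reversal does not change the set of densities that
factorize, by Bayes' rule (`IsCovered.exists_isCondDensity_reverse`).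
-/

namespace TemporalCausal

/-! ### Directed graphs: covered edges and their reversal -/

section Graphs

variable {V : Type*} {K : ℕ}

theorem IsDAG.irrefl {G : Digraph V} (hG : IsDAG G) (a : V) : ¬ G.Adj a a :=
  fun h => hG a (.single h)

theorem IsDAG.asymm {G : Digraph V} (hG : IsDAG G) {a b : V} (h : G.Adj a b) : ¬ G.Adj b a :=
  fun h' => hG a (.tail (.single h) h')

theorem IsDAG.ne {G : Digraph V} (hG : IsDAG G) {a b : V} (h : G.Adj a b) : a ≠ b := by
  rintro rfl
  exact hG.irrefl a h

theorem IsDAG.wellFounded [Finite V] {G : Digraph V} (hG : IsDAG G) :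
    WellFounded (Relation.TransGen G.Adj) :=
  haveI : Std.Irrefl (Relation.TransGen G.Adj) := ⟨hG⟩
  Finite.wellFounded_of_trans_of_irrefl _

theorem IsDAG.wellFounded_swap [Finite V] {G : Digraph V} (hG : IsDAG G) :
    WellFounded (Function.swap (Relation.TransGen G.Adj)) :=
  haveI : Std.Irrefl (Function.swap (Relation.TransGen G.Adj)) := ⟨hG⟩
  haveI : IsTrans V (Function.swap (Relation.TransGen G.Adj)) := ⟨fun _ _ _ h h' => h'.trans h⟩
  Finite.wellFounded_of_trans_of_irrefl _

/-- `a` and `b` are joined by an edge, in one direction or the other. -/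
def Joined (G : Digraph V) (a b : V) : Prop := G.Adj a b ∨ G.Adj b a

theorem Joined.symm {G : Digraph V} {a b : V} (h : Joined G a b) : Joined G b a := Or.symm h

/-- The edge `x → y` is covered: apart from `x` itself, `y` has the same parents as `x`. -/
def IsCovered (G : Digraph V) (x y : V) : Prop :=
  G.Adj x y ∧ ∀ z, z ≠ x → (G.Adj z y ↔ G.Adj z x)

/-- The graph in which the edge `x → y` is replaced by `y → x`. -/
def reverseEdge (G : Digraph V) (x y : V) : Digraph V where
  Adj a b := (G.Adj a b ∧ ¬ (a = x ∧ b = y)) ∨ (a = y ∧ b = x)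

theorem IsCovered.isDAG_reverseEdge {G : Digraph V} (hG : IsDAG G) {x y : V}
    (h : IsCovered G x y) : IsDAG (reverseEdge G x y) := by
  -- a cycle through the new edge `y → x` yields a path from `x` to `y` that avoids `x → y`
  set r : V → V → Prop := fun a b => G.Adj a b ∧ ¬ (a = x ∧ b = y) with hr
  have key : ∀ a b, Relation.TransGen (reverseEdge G x y).Adj a b →
      Relation.TransGen r a b ∨ (Relation.ReflTransGen r a y ∧ Relation.ReflTransGen r x b) := by
    intro a b hab
    induction hab with
    | single hb =>
      rcases hb with hb | ⟨rfl, rfl⟩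
      · exact .inl (.single hb)
      · exact .inr ⟨.refl, .refl⟩
    | tail _ hbc ih =>
      rcases hbc with hbc | ⟨rfl, rfl⟩
      · rcases ih with ih | ⟨h1, h2⟩
        · exact .inl (ih.tail hbc)
        · exact .inr ⟨h1, h2.tail hbc⟩
      · rcases ih with ih | ⟨h1, h2⟩
        · exact .inr ⟨ih.to_reflTransGen, .refl⟩
        · exact .inr ⟨h1, .refl⟩
  have hmono : ∀ a b, r a b → G.Adj a b := fun a b hab => hab.1
  intro v hv
  rcases key v v hv with hc | ⟨h1, h2⟩
  · exact hG v (Relation.TransGen.mono hmono _ _ hc)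
  · have hxy := h2.trans h1
    rcases Relation.ReflTransGen.cases_tail hxy with e | ⟨z, hxz, hzy⟩
    · exact hG.ne h.1 e.symm
    · have hzx : z ≠ x := fun e => hzy.2 ⟨e, rfl⟩
      have hadj := (h.2 z hzx).1 hzy.1
      exact hG x (Relation.TransGen.tail' (Relation.ReflTransGen.mono hmono _ _ hxz) hadj)

theorem IsCovered.reverseEdge {G : Digraph V} (hG : IsDAG G) {x y : V}
    (h : IsCovered G x y) : IsCovered (reverseEdge G x y) y x := by
  have hne := hG.ne h.1
  refine ⟨.inr ⟨rfl, rfl⟩, fun z hz => ?_⟩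
  have := h.2 z
  have := hG.irrefl x
  simp only [TemporalCausal.reverseEdge]
  by_cases hzx : z = x
  · subst hzx; simp_all
  · simp_all

theorem reverseEdge_reverseEdge {G : Digraph V} (hG : IsDAG G) {x y : V} (h : G.Adj x y) :
    reverseEdge (reverseEdge G x y) y x = G := by
  have := hG.asymm h
  have := hG.ne h
  ext a b
  simp only [reverseEdge]
  by_cases h1 : a = x <;> by_cases h2 : b = y <;> by_cases h3 : a = y <;> by_cases h4 : b = x <;>
    simp_all

/-- The graphical counterpart of `I`-Markov equivalence: `G` and `H`, and also their augmented
graphs, have the same adjacencies and the same v-structures. The v-structures of the augmented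
graphs that involve a new vertex are `ζ_k → j ← i` with `j ∈ I_k` and `i ∉ I_k`. -/
structure GraphEquiv (I : InterventionFamily V K) (G H : Digraph V) : Prop where
  joined : ∀ a b, Joined G a b ↔ Joined H a b
  collider : ∀ a b c, a ≠ c → ¬ Joined G a c → (G.Adj a b ∧ G.Adj c b ↔ H.Adj a b ∧ H.Adj c b)
  boundary : ∀ (k : Fin K) (i j : V), j ∈ I k.succ → i ∉ I k.succ → (G.Adj i j ↔ H.Adj i j)

/-- Distinct equivalent graphs differ in the direction of an edge `x → y` that is covered in the
first one (Chickering). Moreover, its ends belong to the same intervention targets. -/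
theorem GraphEquiv.exists_isCovered [Finite V] {I : InterventionFamily V K} {G H : Digraph V}
    (hG : IsDAG G) (hH : IsDAG H) (h : GraphEquiv I G H) (hne : ∃ a b, G.Adj a b ∧ ¬ H.Adj a b) :
    ∃ x y, IsCovered G x y ∧ H.Adj y x ∧ ∀ k : Fin K, x ∈ I k.succ ↔ y ∈ I k.succ := by
  have hflip : ∀ {a b}, G.Adj a b → ¬ H.Adj a b → H.Adj b a := fun hab hn =>
    ((h.joined _ _).1 (.inl hab)).resolve_left hn
  -- `y` is a first head of a differing edge, and `x` a last tail for this `y`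
  obtain ⟨y, ⟨x₀, hx₀, hx₀'⟩, hymin⟩ := hG.wellFounded.has_min
    {y | ∃ x, G.Adj x y ∧ H.Adj y x} (by
      obtain ⟨a, b, hab, hn⟩ := hne
      exact ⟨b, a, hab, hflip hab hn⟩)
  obtain ⟨x, ⟨hxy, hyx⟩, hxmax⟩ := hG.wellFounded_swap.has_min
    {x | G.Adj x y ∧ H.Adj y x} ⟨x₀, hx₀, hx₀'⟩
  have hxmin : ∀ z, G.Adj z x → H.Adj z x := fun z hz => by
    by_contra hn
    exact hymin x ⟨z, hz, hflip hz hn⟩ (.single hxy)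
  refine ⟨x, y, ⟨hxy, fun z hzx => ⟨fun hzy => ?_, fun hzx' => ?_⟩⟩, hyx, fun k => ?_⟩
  · by_cases hj : Joined G z x
    · refine hj.resolve_right fun hxz => ?_
      have hzyH : ¬ H.Adj y z := fun hyz => hxmax z ⟨hzy, hyz⟩ (.single hxz)
      have hzyH' : H.Adj z y := ((h.joined _ _).1 (.inl hzy)).resolve_right hzyH
      have hzxH : ¬ H.Adj x z := fun hxz' =>
        hH x (((Relation.TransGen.single hxz').tail hzyH').tail hyx)
      exact hymin z ⟨x, hxz, hflip hxz hzxH⟩ (.single hzy)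
    · exact absurd hyx (hH.asymm ((h.collider z y x hzx hj).1 ⟨hzy, hxy⟩).2)
  · have hzy : z ≠ y := fun e => hG.asymm hxy (e ▸ hzx')
    by_cases hj : Joined G z y
    · exact hj.resolve_right fun hyz =>
        hG x (((Relation.TransGen.single hxy).tail hyz).tail hzx')
    · exact absurd hxy (hG.asymm ((h.collider z x y hzy hj).2 ⟨hxmin z hzx', hyx⟩).2)
  · by_contra hk
    by_cases hx : x ∈ I k.succ
    · have hy : y ∉ I k.succ := by tauto
      exact hG.asymm hxy ((h.boundary k y x hx hy).2 hyx)
    · have hy : y ∈ I k.succ := by tauto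
      exact hH.asymm hyx ((h.boundary k x y hy hx).1 hxy)

theorem joined_reverseEdge {G : Digraph V} {x y : V} (hxy : G.Adj x y) (a b : V) :
    Joined (reverseEdge G x y) a b ↔ Joined G a b := by
  simp only [Joined, reverseEdge]
  by_cases h1 : a = x <;> by_cases h2 : b = y <;> by_cases h3 : a = y <;> by_cases h4 : b = x <;>
    simp_all

/-- Reversing a covered edge whose ends belong to the same targets gives an equivalent graph. -/
theorem IsCovered.graphEquiv {I : InterventionFamily V K} {G : Digraph V} (hG : IsDAG G) {x y : V}
    (h : IsCovered G x y) (hI : ∀ k : Fin K, x ∈ I k.succ ↔ y ∈ I k.succ) :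
    GraphEquiv I (TemporalCausal.reverseEdge G x y) G := by
  have hne := hG.ne h.1
  refine ⟨joined_reverseEdge h.1, fun a b c hac hj => ?_, fun k i j hj hi => ?_⟩
  · rw [joined_reverseEdge h.1] at hj
    have hj1 : ¬ G.Adj a c := fun e => hj (.inl e)
    have hj2 : ¬ G.Adj c a := fun e => hj (.inr e)
    have ha := h.2 a
    have hc := h.2 c
    have hxy := h.1
    have := hG.asymm hxy
    simp only [TemporalCausal.reverseEdge]
    constructor
    · rintro ⟨⟨h1, h1'⟩ | ⟨rfl, rfl⟩, ⟨h2, h2'⟩ | ⟨h3, h4⟩⟩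
      · exact ⟨h1, h2⟩
      · subst h3 h4
        exact absurd ((ha (hG.ne h1)).2 h1) hj1
      · exact absurd ((hc (hG.ne h2)).2 h2) hj2
      · exact absurd h3.symm hac
    · rintro ⟨h1, h2⟩
      refine ⟨.inl ⟨h1, ?_⟩, .inl ⟨h2, ?_⟩⟩
      · rintro ⟨rfl, rfl⟩
        exact hj2 ((hc hac.symm).1 h2)
      · rintro ⟨rfl, rfl⟩
        exact hj1 ((ha hac).1 h1)
  · simp only [TemporalCausal.reverseEdge]
    have := hI k
    constructor
    · rintro (h1 | ⟨rfl, rfl⟩)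
      · exact h1.1
      · tauto
    · intro h1
      refine .inl ⟨h1, ?_⟩
      rintro ⟨rfl, rfl⟩
      tauto

theorem GraphEquiv.trans {I : InterventionFamily V K} {G H L : Digraph V}
    (h : GraphEquiv I G H) (h' : GraphEquiv I H L) : GraphEquiv I G L :=
  ⟨fun a b => (h.joined a b).trans (h'.joined a b),
   fun a b c hac hj => (h.collider a b c hac hj).trans
    (h'.collider a b c hac fun e => hj ((h.joined a c).2 e)),
   fun k i j hj hi => (h.boundary k i j hj hi).trans (h'.boundary k i j hj hi)⟩

/-- Equivalent graphs are connected by reversals of covered edges: an invariant of graphs that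
these reversals preserve takes the same value on both. -/
theorem GraphEquiv.induction_reverseEdge [Finite V] {α : Sort*} {I : InterventionFamily V K}
    (f : Digraph V → α)
    (hf : ∀ (G : Digraph V) (x y : V), IsDAG G → IsCovered G x y →
      (∀ k : Fin K, x ∈ I k.succ ↔ y ∈ I k.succ) → f (reverseEdge G x y) = f G)
    {G H : Digraph V} (hG : IsDAG G) (hH : IsDAG H) (h : GraphEquiv I G H) : f G = f H := by
  induction hn : Set.ncard {e : V × V | G.Adj e.1 e.2 ∧ ¬ H.Adj e.1 e.2}
    using Nat.strong_induction_on generalizing G with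
  | _ n ih =>
    by_cases hne : ∃ a b, G.Adj a b ∧ ¬ H.Adj a b
    · obtain ⟨x, y, hc, hyx, hI⟩ := h.exists_isCovered hG hH hne
      rw [← hf G x y hG hc hI]
      refine ih _ ?_ (hc.isDAG_reverseEdge hG) ((hc.graphEquiv hG hI).trans h) rfl
      rw [← hn]
      refine Set.ncard_lt_ncard ⟨?_, fun hsub => ?_⟩ (Set.toFinite _)
      · rintro ⟨a, b⟩ ⟨h1 | ⟨rfl, rfl⟩, h2⟩
        · exact ⟨h1.1, h2⟩
        · exact absurd hyx h2
      · have h1 := (hsub (show (x, y) ∈ _ from ⟨hc.1, hH.asymm hyx⟩)).1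
        rcases h1 with h1 | h1
        · exact h1.2 ⟨rfl, rfl⟩
        · exact hG.ne hc.1 h1.1
    · push Not at hne
      congr 1
      ext a b
      refine ⟨hne a b, fun hab => ?_⟩
      exact ((h.joined a b).2 (.inl hab)).resolve_right fun hba => hH.asymm hab (hne _ _ hba)

end Graphs

/-! ### Recovering the graph and the targets from separations -/

section Separation

variable {V : Type*} {K : ℕ}

theorem not_dSep_of_joined {G : Digraph V} {a b : V} (C : Set V) (hab : a ≠ b)
    (h : Joined G a b) : ¬ DSep G {a} {b} C := by
  intro hd
  refine hd a rfl b rfl [a, b] rfl rfl ⟨by simpa using hab, by simpa [Joined] using h⟩ ?_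
  intro x y z hxyz
  simpa using hxyz.length_le

theorem not_dSep_of_two_edges {G : Digraph V} {a b c : V} {C : Set V} (hab : a ≠ b) (hbc : b ≠ c)
    (hac : a ≠ c) (h1 : Joined G a b) (h2 : Joined G b c)
    (hcol : G.Adj a b → G.Adj c b → b ∈ C) (hnon : ¬ (G.Adj a b ∧ G.Adj c b) → b ∉ C) :
    ¬ DSep G {a} {c} C := by
  intro hd
  refine hd a rfl c rfl [a, b, c] rfl rfl
    ⟨by simp [hab, hbc, hac], by simpa [Joined] using ⟨h1, h2⟩⟩ ?_
  intro x y z hxyz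
  have he := hxyz.eq_of_length rfl
  simp only [List.cons.injEq, and_true] at he
  obtain ⟨rfl, rfl, rfl⟩ := he
  exact ⟨fun h => ⟨y, hcol h.1 h.2, .refl⟩, hnon⟩

/-- If all adjacencies of `Gs` are adjacencies of `G`, then the edges of `Gs`, oriented as in `G`, are
pairwise distinct edges of `G`, and all of them if `G` has no more edges than `Gs`. -/
theorem edgeCount_le_of_joined [Finite V] {G Gs : Digraph V} (hGs : IsDAG Gs)
    (h : ∀ a b, Gs.Adj a b → Joined G a b) :
    edgeCount Gs ≤ edgeCount G ∧
      (edgeCount G ≤ edgeCount Gs → ∀ a b, G.Adj a b → Joined Gs a b) := by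
  classical
  set f : V × V → V × V := fun e => if G.Adj e.1 e.2 then e else e.swap with hf
  have hfe : ∀ e, f e = e ∨ f e = e.swap := fun e => by
    simp only [hf]; split_ifs <;> simp
  have hmaps : f '' {e : V × V | Gs.Adj e.1 e.2} ⊆ {e : V × V | G.Adj e.1 e.2} := by
    rintro _ ⟨⟨a, b⟩, hab, rfl⟩
    simp only [hf]
    split_ifs with h1
    · exact h1
    · exact (h a b hab).resolve_left h1
  have hinj : Set.InjOn f {e : V × V | Gs.Adj e.1 e.2} := by
    rintro ⟨a, b⟩ hab ⟨a', b'⟩ hab' hff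
    have hab : Gs.Adj a b := hab
    have hab' : Gs.Adj a' b' := hab'
    have := hGs.asymm hab
    rcases hfe (a, b) with h1 | h1 <;> rcases hfe (a', b') with h2 | h2 <;>
      rw [h1, h2] at hff <;> simp only [Prod.swap_prod_mk, Prod.mk.injEq] at hff <;>
      obtain ⟨rfl, rfl⟩ := hff <;> first | rfl | contradiction
  have hcard := hinj.ncard_image
  have hle := Set.ncard_le_ncard hmaps (Set.toFinite _)
  refine ⟨by rw [edgeCount, edgeCount, ← hcard]; exact hle, fun hge a b hab => ?_⟩
  have heq := Set.eq_of_subset_of_ncard_le hmaps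
    (by rw [hcard]; exact hge) (Set.toFinite _)
  have : (a, b) ∈ f '' {e : V × V | Gs.Adj e.1 e.2} := heq ▸ hab
  obtain ⟨⟨a', b'⟩, hab', hff⟩ := this
  have hab' : Gs.Adj a' b' := hab'
  rcases hfe (a', b') with h1 | h1 <;> rw [h1] at hff <;>
    simp only [Prod.swap_prod_mk, Prod.mk.injEq] at hff <;> obtain ⟨rfl, rfl⟩ := hff
  · exact .inl hab'
  · exact .inr hab'

/-- The separations in the graph of the ground truth `(Gs, Is)` which faithfulness yields if the
ground truth is (a limit of) densities of the model with graph `G` and targets `I`. -/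
structure Separates (G : Digraph V) (I : InterventionFamily V K) (Gs : Digraph V)
    (Is : InterventionFamily V K) : Prop where
  /-- A node is separated by its parents from all other nodes that are not descendants. -/
  indep : ∀ a b, a ≠ b → ¬ G.Adj a b → ¬ Relation.TransGen G.Adj b a →
    DSep Gs {a} {b} {i | G.Adj i b}
  /-- The mechanism of a node is unchanged in the regimes that do not target it. -/
  invariance : ∀ (j : V) (k : Fin K), j ∉ I k.succ →
    DSep (augmented Gs Is) (Sum.inl '' {j}) {Sum.inr k}
      (Sum.inl '' {i | G.Adj i j} ∪ Sum.inr '' {k}ᶜ)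

variable {G Gs : Digraph V} {I Is : InterventionFamily V K}

theorem Separates.joined (h : Separates G I Gs Is) (hG : IsDAG G) (hGs : IsDAG Gs) {a b : V}
    (hab : Gs.Adj a b) : Joined G a b := by
  by_contra hn
  have hne := hGs.ne hab
  have h1 : ¬ G.Adj a b := fun e => hn (.inl e)
  have h2 : ¬ G.Adj b a := fun e => hn (.inr e)
  by_cases hd : Relation.TransGen G.Adj b a
  · exact not_dSep_of_joined _ hne.symm (.inr hab)
      (h.indep b a hne.symm h2 fun hd' => hG a (hd'.trans hd))
  · exact not_dSep_of_joined _ hne (.inl hab) (h.indep a b hne h1 hd)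

theorem Separates.subset (h : Separates G I Gs Is) (hIs : Is 0 = ∅) (q : Fin (K + 1)) :
    Is q ⊆ I q := by
  induction q using Fin.cases with
  | zero => simp [hIs]
  | succ k =>
    intro j hj
    by_contra hn
    have := h.invariance j k hn
    rw [Set.image_singleton] at this
    exact not_dSep_of_joined _ (by simp) (.inr (by simpa [augmented] using hj)) this

theorem targetCount_eq_iff {I J : InterventionFamily V K} (h : ∀ q, I q ⊆ J q) :
    targetCount J ≤ targetCount I ↔ J = I := by
  refine ⟨fun hle => ?_, fun e => by rw [e]⟩
  have hc : ∀ q ∈ Finset.univ, (I q).card ≤ (J q).card := fun q _ => Finset.card_le_card (h q)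
  have heq := (Finset.sum_eq_sum_iff_of_le hc).1 (le_antisymm (Finset.sum_le_sum hc) hle)
  funext q
  exact (Finset.eq_of_subset_of_card_le (h q) (heq q (Finset.mem_univ q)).ge).symm

/-- For equal skeletons, a path `a, b, c` with a collider `b` in only one of the graphs would be
active in `Gs` given the parents of an end that comes last in `G`. -/
theorem Separates.collider (h : Separates G Is Gs Is) (hG : IsDAG G) (hGs : IsDAG Gs)
    (hj : ∀ a b, Joined G a b ↔ Joined Gs a b) {a b c : V} (hac : a ≠ c)
    (hn : ¬ Joined G a c) : G.Adj a b ∧ G.Adj c b ↔ Gs.Adj a b ∧ Gs.Adj c b := by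
  wlog hd : ¬ Relation.TransGen G.Adj c a generalizing a c
  · rw [and_comm, this hac.symm (fun e => hn e.symm) fun hd' => hd fun hd'' =>
      hG a (hd'.trans hd''), and_comm]
  have h1 : ¬ G.Adj a c := fun e => hn (.inl e)
  have hsep := h.indep a c hac h1 hd
  constructor
  · rintro ⟨hab, hcb⟩
    by_contra hcon
    exact not_dSep_of_two_edges (hG.ne hab) (hG.ne hcb).symm hac ((hj _ _).1 (.inl hab))
      ((hj _ _).1 (.inr hcb)) (fun x y => absurd ⟨x, y⟩ hcon) (fun _ hbc => hG.asymm hcb hbc) hsep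
  · rintro ⟨hab, hcb⟩
    have hbc : ¬ G.Adj b c := fun hbc =>
      not_dSep_of_two_edges (hGs.ne hab) (hGs.ne hcb).symm hac (.inl hab) (.inr hcb)
        (fun _ _ => hbc) (fun hcon => absurd ⟨hab, hcb⟩ hcon) hsep
    have hcb' : G.Adj c b := ((hj c b).2 (.inl hcb)).resolve_right hbc
    refine ⟨((hj a b).2 (.inl hab)).resolve_right fun hba => hd ?_, hcb'⟩
    exact (Relation.TransGen.single hcb').tail hba

theorem Separates.boundary (h : Separates G Is Gs Is) (hG : IsDAG G) (hGs : IsDAG Gs)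
    (hj : ∀ a b, Joined G a b ↔ Joined Gs a b) {k : Fin K} {i j : V} (hjk : j ∈ Is k.succ)
    (hik : i ∉ Is k.succ) : G.Adj i j ↔ Gs.Adj i j := by
  have hsep := h.invariance i k hik
  rw [Set.image_singleton] at hsep
  have hmem : ∀ s : Set V, (Sum.inl j : V ⊕ Fin K) ∈ Sum.inl '' s ∪ Sum.inr '' {k}ᶜ ↔ j ∈ s := by
    simp
  -- the path from `i` over `j` to `ζ_k` has a collider in the middle exactly if `i → j`
  have key : i ≠ j → Joined Gs i j → (Gs.Adj i j → G.Adj j i) →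
      (¬ Gs.Adj i j → ¬ G.Adj j i) → False := by
    intro hne hij h1 h2
    refine not_dSep_of_two_edges (a := Sum.inl i) (b := Sum.inl j) (c := Sum.inr k)
      (by simpa using hne) (by simp) (by simp) hij (.inr hjk) (fun h3 _ => ?_) (fun h3 => ?_) hsep
    · exact (hmem _).2 (h1 h3)
    · rw [hmem]
      exact h2 fun h4 => h3 ⟨h4, hjk⟩
  constructor
  · intro hij
    by_contra hn
    exact key (hG.ne hij) ((hj _ _).1 (.inl hij)) (fun h1 => absurd h1 hn)
      fun _ => hG.asymm hij
  · intro hij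
    by_contra hn
    exact key (hGs.ne hij) (.inl hij)
      (fun _ => ((hj _ _).2 (.inl hij)).resolve_left hn) (fun h1 => absurd hij h1)

theorem Separates.edgeCount_le [Finite V] (h : Separates G I Gs Is) (hG : IsDAG G)
    (hGs : IsDAG Gs) : edgeCount Gs ≤ edgeCount G :=
  (edgeCount_le_of_joined hGs fun _ _ => h.joined hG hGs).1

/-- If the candidate is not larger than the ground truth, then it has the true targets and an
equivalent graph. -/
theorem Separates.graphEquiv [Finite V] (h : Separates G I Gs Is) (hG : IsDAG G) (hGs : IsDAG Gs)
    (hIs : Is 0 = ∅) (hcard : edgeCount G ≤ edgeCount Gs)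
    (htarget : targetCount I ≤ targetCount Is) : I = Is ∧ GraphEquiv Is G Gs := by
  obtain rfl := (targetCount_eq_iff (h.subset hIs)).1 htarget
  have hj : ∀ a b, Joined G a b ↔ Joined Gs a b := fun a b => by
    have h1 := (edgeCount_le_of_joined hGs fun _ _ => h.joined hG hGs).2 hcard
    exact ⟨fun e => e.elim (h1 a b) fun e => (h1 b a e).symm,
      fun e => e.elim (h.joined hG hGs) fun e => (h.joined hG hGs e).symm⟩
  exact ⟨rfl, hj, fun _ _ _ hac hn => h.collider hG hGs hj hac hn,
    fun _ _ _ hjk hik => h.boundary hG hGs hj hjk hik⟩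

end Separation

/-! ### Integrating out descendants -/

section Marginal

variable {V : Type*} {G : Digraph V}

/-- The product density defined by one conditional density for each node. -/
noncomputable def productDensity [Fintype V] (c : V → (V → ℝ) → ℝ → ℝ) (x : V → ℝ) : ℝ :=
  ∏ j, c j x (x j)

theorem lmarginal_mul_of_dependsOn [DecidableEq V] {s : Finset V} {u f : (V → ℝ) → ℝ≥0∞}
    (hu : DependsOn u (s : Set V)ᶜ) (hf : Measurable f) :
    (∫⋯∫⁻_s, u * f ∂(fun _ => (volume : Measure ℝ))) =
      u * ∫⋯∫⁻_s, f ∂(fun _ => (volume : Measure ℝ)) := by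
  funext x
  simp only [lmarginal, Pi.mul_apply]
  have hfm : Measurable fun y : s → ℝ => f (Function.updateFinset x s y) :=
    hf.comp measurable_updateFinset
  rw [← lintegral_const_mul (u x) hfm]
  refine lintegral_congr fun y => ?_
  congr 1
  refine hu fun i hi => ?_
  have hi' : i ∉ s := by simpa using hi
  simp [Function.updateFinset, hi']

theorem IsCondDensity.measurable_factor {j : V} {c : (V → ℝ) → ℝ → ℝ} (hc : IsCondDensity G j c) :
    Measurable fun x : V → ℝ => ENNReal.ofReal (c x (x j)) :=
  (hc.measurable.comp (measurable_id.prodMk (measurable_pi_apply j))).ennreal_ofReal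

theorem IsCondDensity.dependsOn_factor {j : V} {c : (V → ℝ) → ℝ → ℝ} (hc : IsCondDensity G j c)
    {s : Set V} (hj : j ∈ s) (hs : ∀ i, G.Adj i j → i ∈ s) :
    DependsOn (fun x : V → ℝ => ENNReal.ofReal (c x (x j))) s := by
  intro x y hxy
  simp only
  rw [hc.parents x y fun i hi => hxy i (hs i hi), hxy j hj]

theorem measurable_prod_factor {c : V → (V → ℝ) → ℝ → ℝ} (hc : ∀ j, IsCondDensity G j (c j))
    (s : Finset V) : Measurable (∏ j ∈ s, fun x : V → ℝ => ENNReal.ofReal (c j x (x j))) := by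
  rw [show (∏ j ∈ s, fun x : V → ℝ => ENNReal.ofReal (c j x (x j))) =
    fun x => ∏ j ∈ s, ENNReal.ofReal (c j x (x j)) from funext fun x => by simp]
  exact Finset.measurable_prod _ fun j _ => (hc j).measurable_factor

theorem lmarginal_erase_mul_factor [DecidableEq V] {c : V → (V → ℝ) → ℝ → ℝ}
    (hc : ∀ j, IsCondDensity G j (c j)) {D : Finset V} {j : V} (hj : j ∈ D)
    (hpar : ∀ i, G.Adj i j → i ∉ D) {w : (V → ℝ) → ℝ≥0∞} (hw : Measurable w)
    (hwD : DependsOn w ((D.erase j : Finset V) : Set V)ᶜ)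
    (hD : (∫⋯∫⁻_D.erase j, (∏ i ∈ D.erase j, fun x : V → ℝ => ENNReal.ofReal (c i x (x i)))
      ∂(fun _ => (volume : Measure ℝ))) = 1) (x : V → ℝ) :
    (∫⋯∫⁻_D, w * ∏ i ∈ D, (fun x : V → ℝ => ENNReal.ofReal (c i x (x i)))
      ∂(fun _ => (volume : Measure ℝ))) x =
      ∫⁻ y, w (Function.update x j y) * ENNReal.ofReal (c j x y) := by
  rw [lmarginal_erase _ (hw.mul (measurable_prod_factor hc D)) hj]
  refine lintegral_congr fun y => ?_
  rw [← Finset.mul_prod_erase _ _ hj, ← mul_assoc,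
    lmarginal_mul_of_dependsOn _ (measurable_prod_factor hc _), hD, mul_one]
  · simp only [Pi.mul_apply, Function.update_self]
    rw [(hc j).parents (Function.update x j y) x fun i hi =>
      Function.update_of_ne (by rintro rfl; exact hpar i hi hj) _ _]
  · intro a b hab
    simp only [Pi.mul_apply]
    have := (hc j).dependsOn_factor (s := ((D.erase j : Finset V) : Set V)ᶜ) (by simp)
      (fun i hi => by simp [hpar i hi]) hab
    simp only at this
    rw [hwD hab, this]

/-- The factors of a set of nodes that is closed under children integrate to one. -/
theorem lmarginal_prod_factor_eq_one [Finite V] [DecidableEq V] (hG : IsDAG G) {c : V → (V → ℝ) → ℝ → ℝ}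
    (hc : ∀ j, IsCondDensity G j (c j)) (D : Finset V)
    (hD : ∀ i ∈ D, ∀ j, G.Adj i j → j ∈ D) :
    (∫⋯∫⁻_D, (∏ i ∈ D, fun x : V → ℝ => ENNReal.ofReal (c i x (x i)))
      ∂(fun _ => (volume : Measure ℝ))) = 1 := by
  induction hn : D.card generalizing D with
  | zero =>
    rw [Finset.card_eq_zero] at hn
    subst hn
    simp
  | succ n ih =>
    -- a node of `D` without parents in `D` is integrated last
    obtain ⟨j, hj, hmin⟩ := hG.wellFounded.has_min (D : Set V)
      (Finset.card_pos.1 (by omega : 0 < D.card))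
    have hj : j ∈ D := hj
    have hpar : ∀ i, G.Adj i j → i ∉ D := fun i hi hiD => hmin i hiD (.single hi)
    have ih' := ih (D.erase j) (fun i hi k hik => by
      have hi' := Finset.mem_of_mem_erase hi
      exact Finset.mem_erase.2 ⟨fun e => hpar i (e ▸ hik) hi', hD i hi' k hik⟩)
      (by rw [Finset.card_erase_of_mem hj, hn]; rfl)
    funext x
    have := lmarginal_erase_mul_factor hc hj hpar (w := 1) measurable_one
      (fun _ _ _ => rfl) ih' x
    rw [one_mul] at this
    rw [this]
    simpa using (hc j).lintegral_eq_one x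

theorem ofReal_productDensity [Fintype V] {c : V → (V → ℝ) → ℝ → ℝ}
    (hc : ∀ j, IsCondDensity G j (c j)) :
    (fun x => ENNReal.ofReal (productDensity c x)) =
      ∏ j, fun x : V → ℝ => ENNReal.ofReal (c j x (x j)) := by
  funext x
  rw [productDensity, ENNReal.ofReal_prod_of_nonneg fun j _ => ((hc j).pos _ _).le,
    Finset.prod_apply]

theorem lintegral_productDensity [Fintype V] (hG : IsDAG G) {c : V → (V → ℝ) → ℝ → ℝ}
    (hc : ∀ j, IsCondDensity G j (c j)) :
    ∫⁻ x, ENNReal.ofReal (productDensity c x) = 1 := by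
  classical
  have := congrFun (lmarginal_prod_factor_eq_one hG hc Finset.univ (by simp)) 0
  rw [lmarginal_univ, ← ofReal_productDensity hc] at this
  exact this

/-- Under the product density, `c j` is the conditional density of the variable `j` given all
variables that are not descendants of `j`. -/
theorem lintegral_indicator_mul_productDensity [Fintype V] (hG : IsDAG G) {c : V → (V → ℝ) → ℝ → ℝ}
    (hc : ∀ j, IsCondDensity G j (c j)) (j : V) {u : (V → ℝ) → ℝ≥0∞} (hu : Measurable u)
    (hud : DependsOn u {i | ¬ Relation.ReflTransGen G.Adj j i}) {B : Set ℝ}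
    (hB : MeasurableSet B) :
    ∫⁻ x, u x * B.indicator 1 (x j) * ENNReal.ofReal (productDensity c x) =
      ∫⁻ x, u x * (∫⁻ y in B, ENNReal.ofReal (c j x y)) *
        ENNReal.ofReal (productDensity c x) := by
  classical
  set D : Finset V := Finset.univ.filter fun i => Relation.ReflTransGen G.Adj j i with hD
  have hmem : ∀ i, i ∈ D ↔ Relation.ReflTransGen G.Adj j i := by simp [hD]
  have hjD : j ∈ D := (hmem j).2 .refl
  have hclosed : ∀ i ∈ D, ∀ k, G.Adj i k → k ∈ D := fun i hi k hik =>
    (hmem k).2 (((hmem i).1 hi).tail hik)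
  have hpar : ∀ i, G.Adj i j → i ∉ D := fun i hi hiD =>
    hG j (Relation.TransGen.tail' ((hmem i).1 hiD) hi)
  have hone := lmarginal_prod_factor_eq_one hG hc (D.erase j) fun i hi k hik => by
    have hi' := Finset.mem_of_mem_erase hi
    exact Finset.mem_erase.2 ⟨fun e => hpar i (e ▸ hik) hi', hclosed i hi' k hik⟩
  set R : (V → ℝ) → ℝ≥0∞ := ∏ i ∈ Dᶜ, fun x : V → ℝ => ENNReal.ofReal (c i x (x i)) with hR
  have hRm : Measurable R := measurable_prod_factor hc _
  have hRd : DependsOn R (D : Set V)ᶜ := by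
    intro x y hxy
    simp only [hR, Finset.prod_apply]
    refine Finset.prod_congr rfl fun i hi => ?_
    have hi' : i ∉ D := Finset.mem_compl.1 hi
    exact (hc i).dependsOn_factor (s := (D : Set V)ᶜ) (by simpa using hi')
      (fun k hk => by simpa using fun hkD => hi' (hclosed k hkD i hk)) hxy
  have hud' : DependsOn u (D : Set V)ᶜ := by
    have : {i | ¬ Relation.ReflTransGen G.Adj j i} = (D : Set V)ᶜ := by
      ext i; simp [hmem]
    rwa [this] at hud
  have hsub : (D : Set V)ᶜ ⊆ ((D.erase j : Finset V) : Set V)ᶜ :=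
    Set.compl_subset_compl.2 (by simp)
  set H : (V → ℝ) → ℝ≥0∞ := fun x => ∫⁻ y in B, ENNReal.ofReal (c j x y) with hH
  have hHm : Measurable H := Measurable.lintegral_prod_right (hc j).measurable.ennreal_ofReal
  have hHd : DependsOn H (D : Set V)ᶜ := by
    intro x y hxy
    simp only [hH]
    rw [(hc j).parents x y fun i hi => hxy i (by simpa using hpar i hi)]
  have hBm : Measurable fun x : V → ℝ => B.indicator (1 : ℝ → ℝ≥0∞) (x j) :=
    (measurable_one.indicator hB).comp (measurable_pi_apply j)
  have hupd : ∀ {f : (V → ℝ) → ℝ≥0∞}, DependsOn f (D : Set V)ᶜ → ∀ (x : V → ℝ) (y : ℝ),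
      f (Function.update x j y) = f x := fun hf x y => hf fun i hi =>
    Function.update_of_ne (fun e => hi (by simpa [e] using hjD)) _ _
  -- both sides agree once the descendants of `j` are integrated out
  have key : ∀ v : (V → ℝ) → ℝ≥0∞, (fun x => u x * v x * ENNReal.ofReal (productDensity c x)) =
      (u * v * R) * ∏ i ∈ D, fun x : V → ℝ => ENNReal.ofReal (c i x (x i)) := fun v => by
    rw [mul_assoc (u * v), hR, mul_comm (∏ i ∈ Dᶜ, _), Finset.prod_mul_prod_compl,
      ← ofReal_productDensity hc]
    rfl
  rw [key, key]
  have hm : ∀ {v : (V → ℝ) → ℝ≥0∞}, Measurable v →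
      Measurable ((u * v * R) * ∏ i ∈ D, fun x : V → ℝ => ENNReal.ofReal (c i x (x i))) :=
    fun hv => ((hu.mul hv).mul hRm).mul (measurable_prod_factor hc _)
  refine lintegral_eq_of_lmarginal_eq (μ := fun _ : V => (volume : Measure ℝ)) D (hm hBm) (hm hHm)
    (funext fun x => ?_)
  rw [lmarginal_erase_mul_factor hc hjD hpar ((hu.mul hBm).mul hRm) ?_ hone,
    lmarginal_erase_mul_factor hc hjD hpar ((hu.mul hHm).mul hRm) ?_ hone]
  · simp only [Pi.mul_apply, hupd hud', hupd hRd, hupd hHd, Function.update_self]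
    have hcm : Measurable fun y => ENNReal.ofReal (c j x y) :=
      ((hc j).measurable.comp measurable_prodMk_left).ennreal_ofReal
    rw [lintegral_const_mul _ hcm, (hc j).lintegral_eq_one, mul_one]
    have : ∀ y, u x * B.indicator 1 y * R x * ENNReal.ofReal (c j x y) =
        u x * R x * B.indicator (fun y => ENNReal.ofReal (c j x y)) y := fun y => by
      by_cases hy : y ∈ B <;> simp [hy]
    simp_rw [this]
    rw [lintegral_const_mul _ (hcm.indicator hB), lintegral_indicator hB]
    ring
  · intro a b hab
    have hab' : ∀ i ∈ (D : Set V)ᶜ, a i = b i := fun i hi => hab i (hsub hi)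
    simp only [Pi.mul_apply]
    rw [hud' hab', hRd hab', hHd hab']
  · intro a b hab
    have hab' : ∀ i ∈ (D : Set V)ᶜ, a i = b i := fun i hi => hab i (hsub hi)
    simp only [Pi.mul_apply]
    rw [hud' hab', hRd hab', hab j (by simp)]

end Marginal

/-! ### Reversing a covered edge by Bayes' rule -/

section Reversal

variable {V : Type*} {G : Digraph V}

/-- A property that fails on a null set along every line parallel to the `y`-axis holds almost
everywhere. -/
theorem ae_of_forall_ae_update [Fintype V] [DecidableEq V] (y : V) {N : Set (V → ℝ)}
    (hN : MeasurableSet N) (h : ∀ z : V → ℝ, ∀ᵐ t : ℝ, Function.update z y t ∉ N) :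
    ∀ᵐ z : V → ℝ, z ∉ N := by
  have h0 : ∫⁻ z : V → ℝ, N.indicator 1 z = ∫⁻ _ : V → ℝ, 0 := by
    refine lintegral_eq_of_lmarginal_eq (μ := fun _ : V => (volume : Measure ℝ)) {y}
      (measurable_one.indicator hN) measurable_const ?_
    rw [lmarginal_singleton, lmarginal_singleton]
    funext z
    refine lintegral_congr_ae ?_
    filter_upwards [h z] with t ht
    simp [ht]
  rw [lintegral_indicator_one hN, lintegral_zero] at h0
  exact measure_eq_zero_iff_ae_notMem.1 h0

/-- The conditional density of the head of a covered edge, as a function of the parents of its tail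
`x`: the variable `x` with density `cx` is integrated out of `cy`. It may be infinite on a null
set. -/
noncomputable def mixedDensity [DecidableEq V] (x : V) (cx cy : (V → ℝ) → ℝ → ℝ) (z : V → ℝ)
    (t : ℝ) : ℝ≥0∞ :=
  ∫⁻ u, ENNReal.ofReal (cx z u * cy (Function.update z x u) t)

section Bayes

variable [DecidableEq V] {x y : V} {cx cy : (V → ℝ) → ℝ → ℝ}

theorem measurable_mixedIntegrand [Countable V] (hcx : IsCondDensity G x cx)
    (hcy : IsCondDensity G y cy) :
    Measurable fun a : ((V → ℝ) × ℝ) × ℝ =>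
      cx a.1.1 a.2 * cy (Function.update a.1.1 x a.2) a.1.2 := by
  have hupd : Measurable fun a : ((V → ℝ) × ℝ) × ℝ => Function.update a.1.1 x a.2 := by
    refine measurable_pi_lambda _ fun i => ?_
    by_cases hi : i = x
    · subst hi; simpa using measurable_snd
    · simp only [Function.update_of_ne hi]
      exact (measurable_pi_apply i).comp (measurable_fst.comp measurable_fst)
  exact (hcx.measurable.comp ((measurable_fst.comp measurable_fst).prodMk measurable_snd)).mul
    (hcy.measurable.comp (hupd.prodMk (measurable_snd.comp measurable_fst)))

theorem measurable_mixedDensity [Countable V] (hcx : IsCondDensity G x cx)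
    (hcy : IsCondDensity G y cy) :
    Measurable fun a : (V → ℝ) × ℝ => mixedDensity x cx cy a.1 a.2 :=
  Measurable.lintegral_prod_right (measurable_mixedIntegrand hcx hcy).ennreal_ofReal

theorem mixedDensity_ne_zero [Countable V] (hcx : IsCondDensity G x cx)
    (hcy : IsCondDensity G y cy) (z : V → ℝ) (t : ℝ) : mixedDensity x cx cy z t ≠ 0 := by
  have hm : Measurable fun u => ENNReal.ofReal (cx z u * cy (Function.update z x u) t) :=
    ((measurable_mixedIntegrand hcx hcy).comp
      (measurable_prodMk_left (x := (z, t)))).ennreal_ofReal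
  intro h
  rw [mixedDensity, lintegral_eq_zero_iff hm] at h
  have : ∀ᵐ _ : ℝ, False := by
    filter_upwards [h] with u hu
    have := mul_pos (hcx.pos z u) (hcy.pos (Function.update z x u) t)
    simp only [Pi.zero_apply, ENNReal.ofReal_eq_zero] at hu
    linarith
  exact this.exists.elim fun _ h => h

theorem lintegral_mixedDensity [Countable V] (hcx : IsCondDensity G x cx)
    (hcy : IsCondDensity G y cy) (z : V → ℝ) : ∫⁻ t, mixedDensity x cx cy z t = 1 := by
  have hm : Measurable fun a : ℝ × ℝ =>
      ENNReal.ofReal (cx z a.2 * cy (Function.update z x a.2) a.1) :=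
    ((measurable_mixedIntegrand hcx hcy).comp (((measurable_const (a := z)).prodMk
      measurable_fst).prodMk measurable_snd)).ennreal_ofReal
  simp only [mixedDensity]
  rw [lintegral_lintegral_swap hm.aemeasurable]
  have : ∀ u, ∫⁻ t, ENNReal.ofReal (cx z u * cy (Function.update z x u) t) =
      ENNReal.ofReal (cx z u) := fun u => by
    have hm' : Measurable fun t => ENNReal.ofReal (cy (Function.update z x u) t) :=
      (hcy.measurable.comp measurable_prodMk_left).ennreal_ofReal
    simp_rw [ENNReal.ofReal_mul (hcx.pos z u).le]
    rw [lintegral_const_mul _ hm', hcy.lintegral_eq_one, mul_one]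
  simp_rw [this]
  exact hcx.lintegral_eq_one z

theorem ae_mixedDensity_ne_top [Countable V] (hcx : IsCondDensity G x cx)
    (hcy : IsCondDensity G y cy) (z : V → ℝ) : ∀ᵐ t, mixedDensity x cx cy z t ≠ ⊤ := by
  have hm : Measurable fun t => mixedDensity x cx cy z t :=
    (measurable_mixedDensity hcx hcy).comp measurable_prodMk_left
  filter_upwards [ae_lt_top hm (by rw [lintegral_mixedDensity hcx hcy]; exact ENNReal.one_ne_top)]
    with t ht using ht.ne

/-- Bayes' rule: conditional densities of `x`, and of `y` given `x`, can be replaced by conditional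
densities of `y`, and of `x` given `y`, with the same product. On the null set where the integral
over `x` diverges, arbitrary positive values are used. -/
theorem IsCovered.exists_isCondDensity_reverse [Fintype V] (hG : IsDAG G) (h : IsCovered G x y)
    (hcx : IsCondDensity G x cx) (hcy : IsCondDensity G y cy) :
    ∃ cx' cy', IsCondDensity (TemporalCausal.reverseEdge G x y) x cx' ∧
      IsCondDensity (TemporalCausal.reverseEdge G x y) y cy' ∧
      ∀ᵐ z : V → ℝ, cx z (z x) * cy z (z y) = cx' z (z x) * cy' z (z y) := by
  classical
  set g := mixedDensity x cx cy with hg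
  have hgm : Measurable fun a : (V → ℝ) × ℝ => g a.1 a.2 := measurable_mixedDensity hcx hcy
  have hne := hG.ne h.1
  -- `g` depends on the parents of `x` only
  have hgpar : ∀ z z' : V → ℝ, (∀ i, G.Adj i x → z i = z' i) → g z = g z' := by
    intro z z' hz
    funext t
    simp only [hg, mixedDensity]
    refine lintegral_congr fun u => ?_
    rw [hcx.parents z z' hz, hcy.parents (Function.update z x u) (Function.update z' x u)]
    intro i hi
    by_cases hix : i = x
    · subst hix; simp
    · simpa [hix] using hz i ((h.2 i hix).1 hi)
  have hparx : ∀ i, G.Adj i x → (TemporalCausal.reverseEdge G x y).Adj i x := fun i hi =>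
    .inl ⟨hi, fun e => hne e.2⟩
  have hpary : ∀ i, G.Adj i x → (TemporalCausal.reverseEdge G x y).Adj i y := fun i hi =>
    .inl ⟨(h.2 i (hG.ne hi)).2 hi, fun e => hG.ne hi e.1⟩
  have hyx : (TemporalCausal.reverseEdge G x y).Adj y x := .inr ⟨rfl, rfl⟩
  have hgpos : ∀ z t, g z t ≠ ⊤ → 0 < (g z t).toReal := fun z t ht =>
    ENNReal.toReal_pos (mixedDensity_ne_zero hcx hcy z t) ht
  have hset : MeasurableSet {a : (V → ℝ) × ℝ | g a.1 a.2 ≠ ⊤} :=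
    (hgm (measurableSet_singleton ⊤)).compl
  have hset' : MeasurableSet {z : V → ℝ | g z (z y) = ⊤} :=
    (hgm.comp (measurable_id.prodMk (measurable_pi_apply y))) (measurableSet_singleton ⊤)
  refine ⟨fun z u => if g z (z y) = ⊤ then cx z u else
      cx z u * cy (Function.update z x u) (z y) / (g z (z y)).toReal,
    fun z t => if g z t ≠ ⊤ then (g z t).toReal else 1, ⟨?_, ?_, ?_, ?_⟩, ⟨?_, ?_, ?_, ?_⟩, ?_⟩
  · have h1 : Measurable fun a : (V → ℝ) × ℝ => ((a.1, a.1 y), a.2) :=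
      (measurable_fst.prodMk ((measurable_pi_apply y).comp measurable_fst)).prodMk measurable_snd
    have h2 : Measurable fun a : (V → ℝ) × ℝ => (g a.1 (a.1 y)).toReal :=
      (hgm.comp (measurable_fst.prodMk ((measurable_pi_apply y).comp
        measurable_fst))).ennreal_toReal
    exact Measurable.ite (measurable_fst hset') hcx.measurable
      (((measurable_mixedIntegrand hcx hcy).comp h1).div h2)
  · intro z u
    split_ifs with ht
    · exact hcx.pos z u
    · exact div_pos (mul_pos (hcx.pos _ _) (hcy.pos _ _)) (hgpos _ _ ht)
  · intro z
    split_ifs with ht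
    · exact hcx.lintegral_eq_one z
    · have hm : Measurable fun u =>
          ENNReal.ofReal (cx z u * cy (Function.update z x u) (z y)) :=
        ((measurable_mixedIntegrand hcx hcy).comp
          (measurable_prodMk_left (x := (z, z y)))).ennreal_ofReal
      simp_rw [ENNReal.ofReal_div_of_pos (hgpos _ _ ht), div_eq_mul_inv]
      rw [lintegral_mul_const _ hm, ENNReal.ofReal_toReal ht]
      exact ENNReal.mul_inv_cancel (mixedDensity_ne_zero hcx hcy _ _) ht
  · intro z z' hz
    have hzy : z y = z' y := hz y hyx
    have hzx : ∀ i, G.Adj i x → z i = z' i := fun i hi => hz i (hparx i hi)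
    funext u
    rw [hgpar z z' hzx, hcx.parents z z' hzx, hzy,
      hcy.parents (Function.update z x u) (Function.update z' x u)]
    intro i hi
    by_cases hix : i = x
    · subst hix; simp
    · simpa [hix] using hzx i ((h.2 i hix).1 hi)
  · exact Measurable.ite hset hgm.ennreal_toReal measurable_const
  · intro z t
    split_ifs with ht
    · exact hgpos z t ht
    · exact one_pos
  · intro z
    rw [← lintegral_mixedDensity hcx hcy z]
    refine lintegral_congr_ae ?_
    filter_upwards [ae_mixedDensity_ne_top hcx hcy z] with t ht
    rw [if_pos ht, ENNReal.ofReal_toReal ht]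
  · intro z z' hz
    rw [hgpar z z' fun i hi => hz i (hpary i hi)]
  · have hfin : ∀ᵐ z : V → ℝ, z ∉ {z : V → ℝ | g z (z y) = ⊤} := by
      refine ae_of_forall_ae_update y hset' fun z => ?_
      filter_upwards [ae_mixedDensity_ne_top hcx hcy z] with t ht
      have : g (Function.update z y t) = g z := hgpar _ _ fun i hi =>
        Function.update_of_ne (by rintro rfl; exact hG.asymm h.1 hi) _ _
      simpa [this] using ht
    filter_upwards [hfin] with z hz
    have hz' : g z (z y) ≠ ⊤ := hz
    rw [if_neg hz', if_pos hz', Function.update_eq_self, div_mul_cancel₀ _ (hgpos _ _ hz').ne']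

end Bayes

variable {K : ℕ} [Fintype V]

theorem IsCovered.markovFamilies_subset {I : InterventionFamily V K} (hG : IsDAG G) {x y : V}
    (h : IsCovered G x y) (hI : ∀ k : Fin K, x ∈ I k.succ ↔ y ∈ I k.succ) :
    markovFamilies I G ⊆ markovFamilies I (TemporalCausal.reverseEdge G x y) := by
  classical
  rintro p ⟨c, hc, hp⟩
  have hne := hG.ne h.1
  choose cx cy hcx hcy hcxy using fun q =>
    h.exists_isCondDensity_reverse hG (hc q x) (hc q y)
  refine ⟨fun q j => if j = x then cx q else if j = y then cy q else c q j, fun q j => ?_,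
    fun q => ?_⟩
  · simp only
    split_ifs with h1 h2
    · exact h1 ▸ hcx q
    · exact h2 ▸ hcy q
    · refine ⟨(hc q j).measurable, (hc q j).pos, (hc q j).lintegral_eq_one, fun z z' hz => ?_⟩
      exact (hc q j).parents z z' fun i hi => hz i (.inl ⟨hi, fun e => h2 e.2⟩)
  · -- `x` and `y` use the densities of the same regime
    have hidx : (if y ∈ I q then q else 0) = (if x ∈ I q then q else 0) := by
      induction q using Fin.cases with
      | zero => simp
      | succ k => simp only [hI k]
    filter_upwards [hp q, hcxy (if x ∈ I q then q else 0)] with z hz hxy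
    rw [hz]
    have hy : y ∈ Finset.univ.erase x := by simp [hne.symm]
    rw [← Finset.mul_prod_erase _ _ (Finset.mem_univ x), ← Finset.mul_prod_erase _ _ hy,
      ← Finset.mul_prod_erase _ _ (Finset.mem_univ x), ← Finset.mul_prod_erase _ _ hy,
      ← mul_assoc, ← mul_assoc]
    congr 1
    · simp only [hidx, if_true, if_neg hne.symm]
      exact hxy
    · refine Finset.prod_congr rfl fun j hj => ?_
      simp only [Finset.mem_erase, Finset.mem_univ, and_true] at hj
      rw [if_neg hj.2, if_neg hj.1]

theorem IsCovered.markovFamilies_eq {I : InterventionFamily V K} (hG : IsDAG G) {x y : V}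
    (h : IsCovered G x y) (hI : ∀ k : Fin K, x ∈ I k.succ ↔ y ∈ I k.succ) :
    markovFamilies I (TemporalCausal.reverseEdge G x y) = markovFamilies I G := by
  refine Set.Subset.antisymm ?_ (h.markovFamilies_subset hG hI)
  have := (h.reverseEdge hG).markovFamilies_subset (h.isDAG_reverseEdge hG) fun k => (hI k).symm
  rwa [reverseEdge_reverseEdge hG h.1] at this

theorem GraphEquiv.iMarkovEquiv {I : InterventionFamily V K} {H : Digraph V} (hG : IsDAG G)
    (hH : IsDAG H) (h : GraphEquiv I G H) : IMarkovEquiv I G H :=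
  h.induction_reverseEdge (markovFamilies I) (fun _ _ _ hG' hc hI => hc.markovFamilies_eq hG' hI)
    hG hH

end Reversal

/-! ### Conditional distributions that are approximated by test functions -/

section CondDistrib

variable {Ω β γ δ : Type*} [MeasurableSpace Ω] [MeasurableSpace β] [MeasurableSpace γ]
  [MeasurableSpace δ]

theorem integrable_of_abs_le {μ : Measure Ω} [IsFiniteMeasure μ] {f : Ω → ℝ} (hf : Measurable f)
    {C : ℝ} (h : ∀ ω, |f ω| ≤ C) : Integrable f μ :=
  Integrable.of_bound hf.aestronglyMeasurable C (ae_of_all _ h)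

theorem measurable_real_kernel (κ : Kernel β γ) {B : Set γ} (hB : MeasurableSet B) :
    Measurable fun x => (κ x).real B :=
  (κ.measurable_coe hB).ennreal_toReal

variable [StandardBorelSpace γ] [Nonempty γ]

theorem integral_mul_indicator_eq_condDistrib {μ : Measure Ω} [IsFiniteMeasure μ] {X : Ω → β}
    {Y : Ω → γ} (hX : Measurable X) (hY : Measurable Y) {B : Set γ} (hB : MeasurableSet B)
    {g : β → ℝ} (hg : Measurable g) {C : ℝ} (hgC : ∀ x, |g x| ≤ C) :
    ∫ ω, g (X ω) * B.indicator 1 (Y ω) ∂μ =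
      ∫ x, g x * (condDistrib Y X μ x).real B ∂(μ.map X) := by
  have hm : Measurable fun a : β × γ => g a.1 * B.indicator (1 : γ → ℝ) a.2 :=
    (hg.comp measurable_fst).mul ((measurable_one.indicator hB).comp measurable_snd)
  have hb : ∀ a : β × γ, |g a.1 * B.indicator (1 : γ → ℝ) a.2| ≤ C := fun a => by
    by_cases ha : a.2 ∈ B
    · simpa [ha] using hgC a.1
    · simpa [ha] using (abs_nonneg _).trans (hgC a.1)
  have h1 := integral_map (μ := μ) (hX.prodMk hY).aemeasurable
    (hm.aestronglyMeasurable (μ := μ.map fun ω => (X ω, Y ω)))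
  rw [← compProd_map_condDistrib hY.aemeasurable,
    Measure.integral_compProd (integrable_of_abs_le hm hb)] at h1
  rw [← h1]
  refine integral_congr_ae (ae_of_all _ fun x => ?_)
  simp only
  rw [integral_const_mul, integral_indicator_one hB]

/-- The deviation of `1_B(Y)` from a function `H` of `X`, tested against a function of `X`, is the
deviation of the conditional probability of `B` from `H`. -/
theorem integral_mul_condDistrib_sub {μ : Measure Ω} [IsFiniteMeasure μ] {X : Ω → β}
    {Y : Ω → γ} (hX : Measurable X) (hY : Measurable Y) {B : Set γ} (hB : MeasurableSet B)
    {g H : β → ℝ} (hg : Measurable g) (hg1 : ∀ x, |g x| ≤ 1) (hH : Measurable H)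
    (hH1 : ∀ x, |H x| ≤ 1) :
    ∫ ω, g (X ω) * (B.indicator 1 (Y ω) - H (X ω)) ∂μ =
      ∫ x, g x * ((condDistrib Y X μ x).real B - H x) ∂(μ.map X) := by
  have hi1 : Integrable (fun ω => g (X ω) * B.indicator (1 : γ → ℝ) (Y ω)) μ :=
    integrable_of_abs_le (C := 1)
      ((hg.comp hX).mul ((measurable_one.indicator hB).comp hY)) fun ω => by
        by_cases ha : Y ω ∈ B <;> simp [ha, hg1]
  have hb2 : ∀ x, |g x * H x| ≤ 1 := fun x => by
    rw [abs_mul]; exact mul_le_one₀ (hg1 x) (abs_nonneg _) (hH1 x)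
  have hi2 : Integrable (fun ω => g (X ω) * H (X ω)) μ :=
    integrable_of_abs_le ((hg.mul hH).comp hX) fun ω => hb2 _
  have hi3 : Integrable (fun x => g x * (condDistrib Y X μ x).real B) (μ.map X) :=
    integrable_of_abs_le (C := 1) (hg.mul (measurable_real_kernel _ hB)) fun x => by
      rw [abs_mul]
      exact mul_le_one₀ (hg1 x) (abs_nonneg _)
        (by rw [abs_of_nonneg measureReal_nonneg]; exact measureReal_le_one)
  have hi4 : Integrable (fun x => g x * H x) (μ.map X) :=
    integrable_of_abs_le (hg.mul hH) hb2
  have he : ∫ x, g x * H x ∂(μ.map X) = ∫ ω, g (X ω) * H (X ω) ∂μ :=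
    integral_map hX.aemeasurable (hg.mul hH).aestronglyMeasurable
  simp_rw [mul_sub]
  rw [integral_sub hi1 hi2, integral_sub hi3 hi4,
    integral_mul_indicator_eq_condDistrib hX hY hB hg hg1, he]

theorem condDistrib_ae_eq_of_forall_measurableSet {μ : Measure Ω} [IsFiniteMeasure μ] {X : Ω → β}
    {Y : Ω → γ} (hY : Measurable Y) {κ : Kernel β γ} [IsMarkovKernel κ]
    (h : ∀ B, MeasurableSet B →
      ∀ᵐ x ∂(μ.map X), (condDistrib Y X μ x).real B = (κ x).real B) :
    condDistrib Y X μ =ᵐ[μ.map X] κ := by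
  refine condDistrib_ae_eq_of_measure_eq_compProd X hY.aemeasurable ?_
  rw [← compProd_map_condDistrib hY.aemeasurable]
  refine Measure.ext_prod fun {s t} hs ht => ?_
  rw [Measure.compProd_apply_prod hs ht, Measure.compProd_apply_prod hs ht]
  refine lintegral_congr_ae (ae_restrict_of_ae ?_)
  filter_upwards [h t ht] with x hx
  exact (measureReal_eq_measureReal_iff).1 hx

/-- Two laws have the same conditional distribution of `Y` given `X` if both conditional
distributions are approximated, in the weak sense, by the same functions of `X`. -/
theorem condDistrib_ae_eq_of_common_approx {μ₀ μ₁ : Measure Ω} [IsFiniteMeasure μ₀]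
    [IsFiniteMeasure μ₁] {X : Ω → β} {Y : Ω → γ} (hX : Measurable X) (hY : Measurable Y)
    (h01 : μ₀ ≪ μ₁) (h10 : μ₁ ≪ μ₀)
    (h : ∀ B : Set γ, MeasurableSet B → ∀ ε : ℝ, 0 < ε → ∃ H : β → ℝ, Measurable H ∧
      (∀ x, |H x| ≤ 1) ∧ ∀ g : β → ℝ, Measurable g → (∀ x, |g x| ≤ 1) →
        |∫ ω, g (X ω) * (B.indicator 1 (Y ω) - H (X ω)) ∂μ₀| ≤ ε ∧
        |∫ ω, g (X ω) * (B.indicator 1 (Y ω) - H (X ω)) ∂μ₁| ≤ ε) :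
    condDistrib Y X μ₀ =ᵐ[μ₀.map X] condDistrib Y X μ₁ := by
  refine condDistrib_ae_eq_of_forall_measurableSet hY fun B hB => ?_
  set ν₀ := μ₀.map X with hν₀
  set ν₁ := μ₁.map X with hν₁
  have hν01 : ν₀ ≪ ν₁ := h01.map hX
  have hν10 : ν₁ ≪ ν₀ := h10.map hX
  set φ₀ : β → ℝ := fun x => (condDistrib Y X μ₀ x).real B with hφ₀
  set φ₁ : β → ℝ := fun x => (condDistrib Y X μ₁ x).real B with hφ₁
  have hφ₀m : Measurable φ₀ := measurable_real_kernel _ hB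
  have hφ₁m : Measurable φ₁ := measurable_real_kernel _ hB
  have hφ₀0 : ∀ x, 0 ≤ φ₀ x := fun x => measureReal_nonneg
  have hφ₁0 : ∀ x, 0 ≤ φ₁ x := fun x => measureReal_nonneg
  have hφ₀1 : ∀ x, φ₀ x ≤ 1 := fun x => measureReal_le_one
  have hφ₁1 : ∀ x, φ₁ x ≤ 1 := fun x => measureReal_le_one
  set r : β → ℝ := fun x => (ν₁.rnDeriv ν₀ x).toReal with hr
  have hrm : Measurable r := (Measure.measurable_rnDeriv _ _).ennreal_toReal
  have hr0 : ∀ x, 0 ≤ r x := fun x => ENNReal.toReal_nonneg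
  have hmax : ∀ x, 0 < max 1 (r x) := fun x => lt_max_of_lt_left one_pos
  set s : β → ℝ := fun x => φ₁ x - φ₀ x with hs
  have hsm : Measurable s := hφ₁m.sub hφ₀m
  have hs1 : ∀ x, |s x| ≤ 1 := fun x => by
    rw [abs_le]
    constructor <;> simp only [hs] <;> linarith [hφ₀0 x, hφ₁0 x, hφ₀1 x, hφ₁1 x]
  -- the weights of the two test functions equalize the measures `ν₀` and `ν₁ = r ν₀`
  set g₀ : β → ℝ := fun x => s x * (r x / max 1 (r x)) with hg₀
  set g₁ : β → ℝ := fun x => s x * (1 / max 1 (r x)) with hg₁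
  have hg₀m : Measurable g₀ := hsm.mul (hrm.div (measurable_const.max hrm))
  have hg₁m : Measurable g₁ := hsm.mul (measurable_const.div (measurable_const.max hrm))
  have hbound : ∀ x t, 0 ≤ t → t ≤ max 1 (r x) → |s x * (t / max 1 (r x))| ≤ 1 := by
    intro x t h0 h1
    rw [abs_mul, abs_of_nonneg (div_nonneg h0 (hmax x).le)]
    exact mul_le_one₀ (hs1 x) (div_nonneg h0 (hmax x).le) ((div_le_one (hmax x)).2 h1)
  have hg₀1 : ∀ x, |g₀ x| ≤ 1 := fun x => hbound x _ (hr0 x) (le_max_right _ _)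
  have hg₁1 : ∀ x, |g₁ x| ≤ 1 := fun x => hbound x _ zero_le_one (le_max_left _ _)
  have hi : ∀ f : β → ℝ, Measurable f → (∀ x, |f x| ≤ 2) →
      Integrable (fun x => g₀ x * f x) ν₀ := fun f hf hf2 =>
    integrable_of_abs_le (C := 2) (hg₀m.mul hf) fun x => by
      rw [abs_mul]
      nlinarith [hg₀1 x, hf2 x, abs_nonneg (g₀ x), abs_nonneg (f x)]
  have hle : ∀ ε : ℝ, 0 < ε → ∫ x, g₀ x * s x ∂ν₀ ≤ 2 * ε := by
    intro ε hε
    obtain ⟨H, hHm, hH1, hH⟩ := h B hB ε hε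
    have e0 := (hH g₀ hg₀m hg₀1).1
    have e1 := (hH g₁ hg₁m hg₁1).2
    rw [integral_mul_condDistrib_sub hX hY hB hg₀m hg₀1 hHm hH1] at e0
    rw [integral_mul_condDistrib_sub hX hY hB hg₁m hg₁1 hHm hH1,
      ← integral_toReal_rnDeriv_mul hν10] at e1
    have e2 : ∫ x, (ν₁.rnDeriv ν₀ x).toReal * (g₁ x * ((condDistrib Y X μ₁ x).real B - H x)) ∂ν₀ =
        ∫ x, g₀ x * (φ₁ x - H x) ∂ν₀ := by
      congr 1
      funext x
      simp only [hg₀, hg₁, hr, hφ₁]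
      ring
    rw [e2] at e1
    have hb : ∀ {f : β → ℝ}, (∀ x, 0 ≤ f x) → (∀ x, f x ≤ 1) → ∀ x, |f x - H x| ≤ 2 := by
      intro f hf0 hf1 x
      have := abs_le.1 (hH1 x)
      rw [abs_le]
      constructor <;> linarith [hf0 x, hf1 x]
    have e3 : ∫ x, g₀ x * s x ∂ν₀ =
        ∫ x, g₀ x * (φ₁ x - H x) ∂ν₀ - ∫ x, g₀ x * (φ₀ x - H x) ∂ν₀ := by
      rw [← integral_sub (hi (fun x => φ₁ x - H x) (hφ₁m.sub hHm) (hb hφ₁0 hφ₁1))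
        (hi (fun x => φ₀ x - H x) (hφ₀m.sub hHm) (hb hφ₀0 hφ₀1))]
      congr 1
      funext x
      simp only [hs]
      ring
    rw [e3]
    have h0 : -ε ≤ ∫ x, g₀ x * (φ₀ x - H x) ∂ν₀ := (abs_le.1 e0).1
    linarith [(abs_le.1 e1).2]
  have hnn : ∀ x, 0 ≤ g₀ x * s x := fun x => by
    have : g₀ x * s x = s x ^ 2 * (r x / max 1 (r x)) := by simp only [hg₀]; ring
    rw [this]
    exact mul_nonneg (sq_nonneg _) (div_nonneg (hr0 x) (hmax x).le)
  have hzero : ∫ x, g₀ x * s x ∂ν₀ = 0 := by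
    refine le_antisymm (le_of_forall_pos_le_add fun ε hε => ?_) (integral_nonneg hnn)
    linarith [hle (ε / 2) (by linarith)]
  rw [integral_eq_zero_iff_of_nonneg hnn (hi s hsm fun x => (hs1 x).trans one_le_two)] at hzero
  filter_upwards [hzero, Measure.rnDeriv_pos' hν01, Measure.rnDeriv_lt_top ν₁ ν₀] with x hx h1 h2
  have hrx : 0 < r x := ENNReal.toReal_pos h1.ne' h2.ne
  have : s x ^ 2 * (r x / max 1 (r x)) = 0 := by
    have e : g₀ x * s x = 0 := hx
    simp only [hg₀] at e
    linarith
  have := (mul_eq_zero.1 this).resolve_right (div_pos hrx (hmax x)).ne'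
  have := pow_eq_zero_iff (two_ne_zero) |>.1 this
  simp only [hs] at this
  linarith

/-- `Y` is independent of `W` given `X` if the conditional distribution of `Y` given `(X, W)` is
approximated, in the weak sense, by functions of `X`. -/
theorem condDistrib_prod_ae_eq_of_approx {μ : Measure Ω} [IsFiniteMeasure μ] {X : Ω → β}
    {W : Ω → δ} {Y : Ω → γ} (hX : Measurable X) (hW : Measurable W) (hY : Measurable Y)
    (h : ∀ B : Set γ, MeasurableSet B → ∀ ε : ℝ, 0 < ε → ∃ H : β → ℝ, Measurable H ∧
      (∀ x, |H x| ≤ 1) ∧ ∀ g : β × δ → ℝ, Measurable g → (∀ x, |g x| ≤ 1) →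
        |∫ ω, g (X ω, W ω) * (B.indicator 1 (Y ω) - H (X ω)) ∂μ| ≤ ε) :
    condDistrib Y (fun ω => (X ω, W ω)) μ =ᵐ[μ.map (fun ω => (X ω, W ω))]
      (condDistrib Y X μ).prodMkRight δ := by
  have hXW : Measurable fun ω => (X ω, W ω) := hX.prodMk hW
  refine condDistrib_ae_eq_of_forall_measurableSet hY fun B hB => ?_
  set ρ := μ.map fun ω => (X ω, W ω) with hρ
  set φ : β × δ → ℝ := fun a => (condDistrib Y (fun ω => (X ω, W ω)) μ a).real B with hφ
  set ψ : β → ℝ := fun x => (condDistrib Y X μ x).real B with hψ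
  have hφm : Measurable φ := measurable_real_kernel _ hB
  have hψm : Measurable ψ := measurable_real_kernel _ hB
  have hφ0 : ∀ x, 0 ≤ φ x := fun x => measureReal_nonneg
  have hψ0 : ∀ x, 0 ≤ ψ x := fun x => measureReal_nonneg
  have hφ1 : ∀ x, φ x ≤ 1 := fun x => measureReal_le_one
  have hψ1 : ∀ x, ψ x ≤ 1 := fun x => measureReal_le_one
  set D : β × δ → ℝ := fun a => φ a - ψ a.1 with hD
  have hDm : Measurable D := hφm.sub (hψm.comp measurable_fst)
  have hD1 : ∀ a, |D a| ≤ 1 := fun a => by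
    rw [abs_le]
    constructor <;> simp only [hD] <;> linarith [hφ0 a, hψ0 a.1, hφ1 a, hψ1 a.1]
  -- `D` is orthogonal to all functions of `X`
  have horth : ∀ u : β → ℝ, Measurable u → (∀ x, |u x| ≤ 2) →
      ∫ a, u a.1 * D a ∂ρ = 0 := by
    intro u hu hu2
    have e1 := integral_mul_indicator_eq_condDistrib (μ := μ) hXW hY hB
      (hu.comp measurable_fst) (fun a => hu2 a.1)
    have e2 := integral_mul_indicator_eq_condDistrib (μ := μ) hX hY hB hu hu2
    have e3 : ∫ a : β × δ, u a.1 * ψ a.1 ∂ρ = ∫ x, u x * ψ x ∂(μ.map X) := by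
      have e4 : ∫ a : β × δ, u a.1 * ψ a.1 ∂ρ = ∫ ω, u (X ω) * ψ (X ω) ∂μ :=
        integral_map hXW.aemeasurable
          ((hu.mul hψm).comp measurable_fst).aestronglyMeasurable
      have e5 : ∫ x, u x * ψ x ∂(μ.map X) = ∫ ω, u (X ω) * ψ (X ω) ∂μ :=
        integral_map hX.aemeasurable (hu.mul hψm).aestronglyMeasurable
      rw [e4, e5]
    have hi : ∀ f : β × δ → ℝ, Measurable f → (∀ a, 0 ≤ f a) → (∀ a, f a ≤ 1) →
        Integrable (fun a : β × δ => u a.1 * f a) ρ := fun f hf hf0 hf1 =>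
      integrable_of_abs_le (C := 2) ((hu.comp measurable_fst).mul hf) fun a => by
        rw [abs_mul, abs_of_nonneg (hf0 a)]
        nlinarith [hu2 a.1, hf0 a, hf1 a, abs_nonneg (u a.1)]
    simp only [hD, mul_sub]
    rw [integral_sub (hi φ hφm hφ0 hφ1)
      (hi (fun a => ψ a.1) (hψm.comp measurable_fst) (fun a => hψ0 a.1) fun a => hψ1 a.1)]
    simp only [Function.comp_apply] at e1
    rw [← e1, e3, ← e2, sub_self]
  have hiD : Integrable (fun a => D a * D a) ρ :=
    integrable_of_abs_le (C := 1) (hDm.mul hDm) fun a => by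
      rw [abs_mul]; exact mul_le_one₀ (hD1 a) (abs_nonneg _) (hD1 a)
  have hle : ∀ ε : ℝ, 0 < ε → ∫ a, D a * D a ∂ρ ≤ ε := by
    intro ε hε
    obtain ⟨H, hHm, hH1, hH⟩ := h B hB ε hε
    have e0 := hH D hDm hD1
    have e1 := integral_mul_condDistrib_sub (μ := μ) (H := fun a : β × δ => H a.1) hXW hY hB hDm hD1
      (hHm.comp measurable_fst) (fun a => hH1 a.1)
    rw [e1] at e0
    have hb : ∀ x, |H x - ψ x| ≤ 2 := fun x => by
      have := abs_le.1 (hH1 x)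
      rw [abs_le]
      constructor <;> linarith [hψ0 x, hψ1 x]
    have e2 := horth (fun x => H x - ψ x) (hHm.sub hψm) hb
    have hi1 : Integrable (fun a => D a * (φ a - H a.1)) ρ :=
      integrable_of_abs_le (C := 2) (hDm.mul (hφm.sub (hHm.comp measurable_fst))) fun a => by
        have h1 := abs_le.1 (hH1 a.1)
        have h2 : |φ a - H a.1| ≤ 2 := by
          rw [abs_le]
          constructor <;> linarith [hφ0 a, hφ1 a]
        rw [abs_mul]
        nlinarith [hD1 a, abs_nonneg (D a), abs_nonneg (φ a - H a.1)]
    have hi2 : Integrable (fun a : β × δ => (H a.1 - ψ a.1) * D a) ρ :=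
      integrable_of_abs_le (C := 2) (((hHm.sub hψm).comp measurable_fst).mul hDm) fun a => by
        rw [abs_mul]
        nlinarith [hD1 a, hb a.1, abs_nonneg (D a), abs_nonneg (H a.1 - ψ a.1)]
    have e3 : ∫ a, D a * D a ∂ρ =
        ∫ a, D a * (φ a - H a.1) ∂ρ + ∫ a, (H a.1 - ψ a.1) * D a ∂ρ := by
      rw [← integral_add hi1 hi2]
      congr 1
      funext a
      simp only [hD]
      ring
    rw [e3, e2, add_zero]
    exact (abs_le.1 e0).2
  have hnn : ∀ a, 0 ≤ D a * D a := fun a => mul_self_nonneg _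
  have hzero : ∫ a, D a * D a ∂ρ = 0 :=
    le_antisymm (le_of_forall_pos_le_add fun ε hε => by simpa using hle ε hε) (integral_nonneg hnn)
  rw [integral_eq_zero_iff_of_nonneg hnn hiD] at hzero
  filter_upwards [hzero] with a ha
  have : D a = 0 := mul_self_eq_zero.1 ha
  rw [Kernel.prodMkRight_apply]
  exact sub_eq_zero.1 this

end CondDistrib

/-! ### Separations implied by approximability -/

section Approximation

variable {V : Type*} {K : ℕ} {G : Digraph V} {j : V}

/-- The conditional probability of `B`, as a real number. -/
noncomputable def condProb (c : (V → ℝ) → ℝ → ℝ) (B : Set ℝ) (x : V → ℝ) : ℝ :=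
  (∫⁻ y in B, ENNReal.ofReal (c x y)).toReal

theorem IsCondDensity.setLIntegral_le_one {c : (V → ℝ) → ℝ → ℝ} (hc : IsCondDensity G j c)
    (B : Set ℝ) (x : V → ℝ) : ∫⁻ y in B, ENNReal.ofReal (c x y) ≤ 1 :=
  (setLIntegral_le_lintegral _ _).trans (hc.lintegral_eq_one x).le

theorem measurable_condProb {c : (V → ℝ) → ℝ → ℝ} (hc : IsCondDensity G j c) (B : Set ℝ) :
    Measurable (condProb c B) :=
  (Measurable.lintegral_prod_right (ν := volume.restrict B)
    hc.measurable.ennreal_ofReal).ennreal_toReal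

theorem condProb_nonneg (c : (V → ℝ) → ℝ → ℝ) (B : Set ℝ) (x : V → ℝ) : 0 ≤ condProb c B x :=
  ENNReal.toReal_nonneg

theorem condProb_le_one {c : (V → ℝ) → ℝ → ℝ} (hc : IsCondDensity G j c) (B : Set ℝ)
    (x : V → ℝ) : condProb c B x ≤ 1 :=
  ENNReal.toReal_le_of_le_ofReal zero_le_one (by simpa using hc.setLIntegral_le_one B x)

theorem abs_mul_indicator_sub_le_one {t u : ℝ} {B : Set ℝ} {y : ℝ} (ht : |t| ≤ 1) (hu0 : 0 ≤ u)
    (hu1 : u ≤ 1) : |t * (B.indicator 1 y - u)| ≤ 1 := by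
  rw [abs_mul]
  refine mul_le_one₀ ht (abs_nonneg _) ?_
  rw [abs_le]
  by_cases hy : y ∈ B <;> simp [hy] <;> constructor <;> linarith

open Classical in
/-- A vector of parent values, extended by zero. -/
noncomputable def extendByZero (C : Set V) (z : C → ℝ) (i : V) : ℝ :=
  if h : i ∈ C then z ⟨i, h⟩ else 0

theorem measurable_extendByZero (C : Set V) : Measurable (extendByZero C) := by
  classical
  refine measurable_pi_lambda _ fun i => ?_
  by_cases h : i ∈ C
  · simpa [extendByZero, h] using measurable_pi_apply (⟨i, h⟩ : C)
  · simp [extendByZero, h]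

theorem measurable_domRestrict (C : Set V) :
    Measurable (C.domRestrict (π := fun _ => ℝ)) :=
  measurable_pi_lambda _ fun i => measurable_pi_apply i.1

theorem dependsOn_comp_domRestrict {α : Type*} {C s : Set V} (hCs : C ⊆ s)
    (g : (C → ℝ) → α) :
    DependsOn (fun x : V → ℝ => g (C.domRestrict (π := fun _ => ℝ) x)) s := by
  intro x y hxy
  simp only
  congr 1
  funext i
  exact hxy i (hCs i.2)

theorem IsDAG.parents_subset (hG : IsDAG G) (j : V) :
    {i | G.Adj i j} ⊆ {i | ¬ Relation.ReflTransGen G.Adj j i} :=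
  fun _ hi hji => hG j (Relation.TransGen.tail' hji hi)

variable [Fintype V]

theorem JointDensity.integrable (p : JointDensity V) : Integrable p.toFun :=
  ⟨p.measurable.aestronglyMeasurable, by
    rw [hasFiniteIntegral_iff_ofReal (ae_of_all _ p.nonneg), p.lintegral_eq_one]
    exact ENNReal.one_lt_top⟩

theorem JointDensity.integral_law (p : JointDensity V) (g : (V → ℝ) → ℝ) :
    ∫ x, g x ∂p.law = ∫ x, p.toFun x * g x := by
  rw [JointDensity.law, integral_withDensity_eq_integral_toReal_smul p.measurable.ennreal_ofReal
    (ae_of_all _ fun _ => ENNReal.ofReal_lt_top)]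
  simp_rw [ENNReal.toReal_ofReal (p.nonneg _), smul_eq_mul]

theorem productDensity_pos {c : V → (V → ℝ) → ℝ → ℝ}
    (hc : ∀ j, IsCondDensity G j (c j)) (x : V → ℝ) : 0 < productDensity c x :=
  Finset.prod_pos fun j _ => (hc j).pos _ _

theorem measurable_productDensity {c : V → (V → ℝ) → ℝ → ℝ}
    (hc : ∀ j, IsCondDensity G j (c j)) : Measurable (productDensity c) :=
  Finset.measurable_prod _ fun j _ =>
    (hc j).measurable.comp (measurable_id.prodMk (measurable_pi_apply j))

theorem integrable_productDensity (hG : IsDAG G) {c : V → (V → ℝ) → ℝ → ℝ}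
    (hc : ∀ j, IsCondDensity G j (c j)) : Integrable (productDensity c) :=
  ⟨(measurable_productDensity hc).aestronglyMeasurable, by
    rw [hasFiniteIntegral_iff_ofReal (ae_of_all _ fun x => (productDensity_pos hc x).le),
      lintegral_productDensity hG hc]
    exact ENNReal.one_lt_top⟩

open Classical in
/-- The product density of regime `q`: the nodes outside the target use the conditional densities
of the observational regime. -/
noncomputable def regimeDensity (I : InterventionFamily V K)
    (c : Fin (K + 1) → V → (V → ℝ) → ℝ → ℝ) (q : Fin (K + 1)) (x : V → ℝ) : ℝ :=
  productDensity (fun j => c (if j ∈ I q then q else 0) j) x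

/-- The densities `p` are limits in `L¹` of families that factorize according to `(I, G)`. -/
def IsApproximable (I : InterventionFamily V K) (G : Digraph V)
    (p : Fin (K + 1) → JointDensity V) : Prop :=
  ∀ ε : ℝ, 0 < ε → ∃ c : Fin (K + 1) → V → (V → ℝ) → ℝ → ℝ,
    (∀ q j, IsCondDensity G j (c q j)) ∧
    ∀ q, ∫ x, |(p q).toFun x - regimeDensity I c q x| ≤ ε

theorem integral_mul_condProb_of_nonneg (hG : IsDAG G) {c : V → (V → ℝ) → ℝ → ℝ}
    (hc : ∀ j, IsCondDensity G j (c j)) (j : V) {g : (V → ℝ) → ℝ} (hg : Measurable g)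
    (hg0 : ∀ x, 0 ≤ g x) (hgd : DependsOn g {i | ¬ Relation.ReflTransGen G.Adj j i}) {B : Set ℝ}
    (hB : MeasurableSet B) :
    ∫ x, g x * B.indicator 1 (x j) * productDensity c x =
      ∫ x, g x * condProb (c j) B x * productDensity c x := by
  have hf := productDensity_pos hc
  have hfm := measurable_productDensity hc
  have hB0 : ∀ y, (0 : ℝ) ≤ B.indicator 1 y := fun y =>
    Set.indicator_nonneg (fun _ _ => zero_le_one) y
  have hBm : Measurable fun x : V → ℝ => B.indicator (1 : ℝ → ℝ) (x j) :=
    (measurable_one.indicator hB).comp (measurable_pi_apply j)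
  rw [integral_eq_lintegral_of_nonneg_ae
      (ae_of_all _ fun x => mul_nonneg (mul_nonneg (hg0 x) (hB0 _)) (hf x).le)
      ((hg.mul hBm).mul hfm).aestronglyMeasurable,
    integral_eq_lintegral_of_nonneg_ae
      (ae_of_all _ fun x => mul_nonneg (mul_nonneg (hg0 x) (condProb_nonneg _ _ _)) (hf x).le)
      ((hg.mul (measurable_condProb (hc j) B)).mul hfm).aestronglyMeasurable]
  congr 1
  have h1 : ∀ x, ENNReal.ofReal (g x * B.indicator 1 (x j) * productDensity c x) =
      ENNReal.ofReal (g x) * B.indicator 1 (x j) * ENNReal.ofReal (productDensity c x) := by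
    intro x
    rw [ENNReal.ofReal_mul (mul_nonneg (hg0 x) (hB0 _)), ENNReal.ofReal_mul (hg0 x)]
    by_cases hx : x j ∈ B <;> simp [hx]
  have h2 : ∀ x, ENNReal.ofReal (g x * condProb (c j) B x * productDensity c x) =
      ENNReal.ofReal (g x) * (∫⁻ y in B, ENNReal.ofReal (c j x y)) *
        ENNReal.ofReal (productDensity c x) := by
    intro x
    rw [ENNReal.ofReal_mul (mul_nonneg (hg0 x) (condProb_nonneg _ _ _)),
      ENNReal.ofReal_mul (hg0 x), condProb, ENNReal.ofReal_toReal
        (((hc j).setLIntegral_le_one B x).trans_lt ENNReal.one_lt_top).ne]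
  simp_rw [h1, h2]
  refine lintegral_indicator_mul_productDensity hG hc j hg.ennreal_ofReal (fun x y hxy => ?_) hB
  simp only
  rw [hgd hxy]

/-- The conditional probabilities are orthogonal to functions of non-descendants. -/
theorem integral_mul_indicator_sub_condProb (hG : IsDAG G) {c : V → (V → ℝ) → ℝ → ℝ}
    (hc : ∀ j, IsCondDensity G j (c j)) (j : V) {g : (V → ℝ) → ℝ} (hg : Measurable g)
    (hg1 : ∀ x, |g x| ≤ 1) (hgd : DependsOn g {i | ¬ Relation.ReflTransGen G.Adj j i})
    {B : Set ℝ} (hB : MeasurableSet B) :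
    ∫ x, productDensity c x * (g x * (B.indicator 1 (x j) - condProb (c j) B x)) = 0 := by
  have hBm : Measurable fun x : V → ℝ => B.indicator (1 : ℝ → ℝ) (x j) :=
    (measurable_one.indicator hB).comp (measurable_pi_apply j)
  have hHm := measurable_condProb (hc j) B
  have hB1 : ∀ y, |B.indicator (1 : ℝ → ℝ) y| ≤ 1 := fun y => by
    by_cases hy : y ∈ B <;> simp [hy]
  have hH1 : ∀ x, |condProb (c j) B x| ≤ 1 := fun x => by
    rw [abs_of_nonneg (condProb_nonneg _ _ _)]; exact condProb_le_one (hc j) B x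
  have hint : ∀ u : (V → ℝ) → ℝ, Measurable u → (∀ x, |u x| ≤ 2) →
      Integrable fun x => u x * productDensity c x := fun u hu hu2 =>
    (integrable_productDensity hG hc).bdd_mul hu.aestronglyMeasurable (ae_of_all _ hu2)
  -- the shift by one makes the test function nonnegative
  have hb2 : ∀ (v : (V → ℝ) → ℝ), (∀ x, |v x| ≤ 1) → ∀ x, |(g x + 1) * v x| ≤ 2 := by
    intro v hv x
    rw [abs_mul]
    have h1 : |g x + 1| ≤ 2 := by
      have := abs_le.1 (hg1 x)
      rw [abs_le]
      constructor <;> linarith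
    nlinarith [hv x, abs_nonneg (v x), abs_nonneg (g x + 1)]
  have hb1 : ∀ (v : (V → ℝ) → ℝ), (∀ x, |v x| ≤ 1) → ∀ x, |1 * v x| ≤ 2 := by
    intro v hv x
    rw [one_mul]
    exact (hv x).trans one_le_two
  have e1 := integral_mul_condProb_of_nonneg hG hc j (hg.add_const 1)
    (fun x => by linarith [(abs_le.1 (hg1 x)).1])
    (fun x y hxy => by simp only; rw [hgd hxy]) hB
  have e2 := integral_mul_condProb_of_nonneg hG hc j (g := fun _ => 1) measurable_const
    (fun _ => zero_le_one) (fun _ _ _ => rfl) hB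
  have i1 := hint (fun x => (g x + 1) * B.indicator 1 (x j)) ((hg.add_const 1).mul hBm)
    (hb2 _ fun x => hB1 _)
  have i2 := hint (fun x => (g x + 1) * condProb (c j) B x) ((hg.add_const 1).mul hHm) (hb2 _ hH1)
  have i3 := hint (fun x => 1 * B.indicator 1 (x j)) (measurable_const.mul hBm)
    (hb1 _ fun x => hB1 _)
  have i4 := hint (fun x => 1 * condProb (c j) B x) (measurable_const.mul hHm) (hb1 _ hH1)
  have h1 := integral_sub i1 i2
  have h2 := integral_sub i3 i4
  rw [e1, sub_self] at h1
  rw [e2, sub_self] at h2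
  have h3 := integral_sub (i1.sub i2) (i3.sub i4)
  simp only [Pi.sub_apply] at h3
  rw [h1, h2, sub_self] at h3
  rw [← h3]
  congr 1
  funext x
  ring

/-- The orthogonality persists, up to the distance in `L¹`, for densities nearby. -/
theorem abs_integral_law_le (hG : IsDAG G) {c : V → (V → ℝ) → ℝ → ℝ}
    (hc : ∀ j, IsCondDensity G j (c j)) (j : V) {g : (V → ℝ) → ℝ} (hg : Measurable g)
    (hg1 : ∀ x, |g x| ≤ 1) (hgd : DependsOn g {i | ¬ Relation.ReflTransGen G.Adj j i})
    {B : Set ℝ} (hB : MeasurableSet B) (p : JointDensity V) :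
    |∫ x, g x * (B.indicator 1 (x j) - condProb (c j) B x) ∂p.law| ≤
      ∫ x, |p.toFun x - productDensity c x| := by
  have hBm : Measurable fun x : V → ℝ => B.indicator (1 : ℝ → ℝ) (x j) :=
    (measurable_one.indicator hB).comp (measurable_pi_apply j)
  set w : (V → ℝ) → ℝ := fun x => g x * (B.indicator 1 (x j) - condProb (c j) B x) with hw
  have hwm : Measurable w := hg.mul (hBm.sub (measurable_condProb (hc j) B))
  have hw1 : ∀ x, |w x| ≤ 1 := fun x =>
    abs_mul_indicator_sub_le_one (hg1 x) (condProb_nonneg _ _ _) (condProb_le_one (hc j) B x)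
  have hf := integrable_productDensity hG hc
  have i1 : Integrable fun x => p.toFun x * w x :=
    p.integrable.mul_bdd hwm.aestronglyMeasurable (ae_of_all _ hw1)
  have i2 : Integrable fun x => productDensity c x * w x :=
    hf.mul_bdd hwm.aestronglyMeasurable (ae_of_all _ hw1)
  have h0 : ∫ x, productDensity c x * w x = 0 :=
    integral_mul_indicator_sub_condProb hG hc j hg hg1 hgd hB
  rw [p.integral_law, ← sub_zero (∫ x, p.toFun x * w x), ← h0, ← integral_sub i1 i2]
  refine (abs_integral_le_integral_abs).trans
    (integral_mono (i1.sub i2).abs (p.integrable.sub hf).abs fun x => ?_)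
  simp only
  rw [← sub_mul, abs_mul]
  exact mul_le_of_le_one_right (abs_nonneg _) (hw1 x)

/-- In all regimes that do not target `j`, the law of the variable `j` given the non-descendants is
approximated by the same function of the parents. -/
theorem IsApproximable.exists_test {I : InterventionFamily V K} {p : Fin (K + 1) → JointDensity V}
    (h : IsApproximable I G p) (hG : IsDAG G) (j : V) {B : Set (({j} : Set V) → ℝ)}
    (hB : MeasurableSet B) {ε : ℝ} (hε : 0 < ε) :
    ∃ H : ({i | G.Adj i j} → ℝ) → ℝ, Measurable H ∧ (∀ z, |H z| ≤ 1) ∧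
      ∀ q, (q = 0 ∨ j ∉ I q) → ∀ g : (V → ℝ) → ℝ, Measurable g → (∀ x, |g x| ≤ 1) →
        DependsOn g {i | ¬ Relation.ReflTransGen G.Adj j i} →
        |∫ x, g x * (B.indicator 1 (({j} : Set V).domRestrict (π := fun _ => ℝ) x) -
          H (Set.domRestrict (π := fun _ => ℝ) {i | G.Adj i j} x)) ∂(p q).law| ≤ ε := by
  classical
  obtain ⟨c, hc, hp⟩ := h ε hε
  set B' : Set ℝ := (fun t : ℝ => fun _ : ({j} : Set V) => t) ⁻¹' B with hB'
  have hB'm : MeasurableSet B' := (measurable_pi_lambda _ fun _ => measurable_id) hB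
  refine ⟨fun z => condProb (c 0 j) B' (extendByZero _ z),
    (measurable_condProb (hc 0 j) B').comp (measurable_extendByZero _), fun z => ?_,
    fun q hq g hg hg1 hgd => ?_⟩
  · rw [abs_of_nonneg (condProb_nonneg _ _ _)]
    exact condProb_le_one (hc 0 j) _ _
  · have hidx : (if j ∈ I q then q else 0) = 0 := by
      rcases hq with rfl | hq <;> simp_all
    have h1 := abs_integral_law_le hG (fun i => hc (if i ∈ I q then q else 0) i) j hg hg1 hgd
      hB'm (p q)
    refine le_trans (le_of_eq ?_) (h1.trans (hp q))
    congr 2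
    funext x
    have e1 : B.indicator (1 : (({j} : Set V) → ℝ) → ℝ)
        (({j} : Set V).domRestrict (π := fun _ => ℝ) x) = B'.indicator 1 (x j) := by
      have : ({j} : Set V).domRestrict (π := fun _ => ℝ) x = fun _ => x j := by
        funext i
        obtain ⟨i, rfl⟩ := i
        rfl
      rw [this]
      rfl
    have e2 : condProb (c 0 j) B' (extendByZero {i | G.Adj i j}
        (Set.domRestrict (π := fun _ => ℝ) {i | G.Adj i j} x)) = condProb (c 0 j) B' x := by
      simp only [condProb]
      rw [(hc 0 j).parents _ x fun i hi => by simp [extendByZero, hi]]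
    rw [e1, hidx, ← e2]

theorem IsApproximable.condIndepVars {I : InterventionFamily V K}
    {p : Fin (K + 1) → JointDensity V} (h : IsApproximable I G p) (hG : IsDAG G) {a b : V}
    (hab : a ≠ b) (hd : ¬ Relation.TransGen G.Adj b a) :
    CondIndepVars (p 0) {a} {b} {i | G.Adj i b} := by
  rw [CondIndepVars, condIndepFun_iff_condDistrib_prod_ae_eq_prodMkRight
    (measurable_domRestrict {b}) (measurable_domRestrict {a}) (measurable_domRestrict _)]
  refine condDistrib_prod_ae_eq_of_approx (measurable_domRestrict _) (measurable_domRestrict _)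
    (measurable_domRestrict _) fun B hB ε hε => ?_
  obtain ⟨H, hHm, hH1, hH⟩ := h.exists_test hG b hB hε
  refine ⟨H, hHm, hH1, fun g hg hg1 => hH 0 (.inl rfl) _
    (hg.comp ((measurable_domRestrict _).prodMk (measurable_domRestrict _))) (fun x => hg1 _) ?_⟩
  intro x y hxy
  have e1 : ∀ C ⊆ {i | ¬ Relation.ReflTransGen G.Adj b i},
      C.domRestrict (π := fun _ => ℝ) x = C.domRestrict (π := fun _ => ℝ) y :=
    fun C hC => funext fun i => hxy i (hC i.2)
  simp only
  rw [e1 _ (hG.parents_subset b), e1 {a}]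
  rintro i rfl hbi
  rcases Relation.reflTransGen_iff_eq_or_transGen.1 hbi with e | e
  · exact hab e
  · exact hd e

theorem law_absolutelyContinuous (p p' : JointDensity V) (hp' : ∀ᵐ x, 0 < p'.toFun x) :
    p.law ≪ p'.law := by
  refine (withDensity_absolutelyContinuous _ _).trans
    (withDensity_absolutelyContinuous' p'.measurable.ennreal_ofReal.aemeasurable ?_)
  filter_upwards [hp'] with x hx
  simpa using hx

theorem IsApproximable.sameConditional {I : InterventionFamily V K}
    {p : Fin (K + 1) → JointDensity V} (h : IsApproximable I G p) (hG : IsDAG G)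
    (hpos : ∀ q, ∀ᵐ x, 0 < (p q).toFun x) {j : V} {q : Fin (K + 1)} (hj : j ∉ I q) :
    SameConditional (p 0) (p q) {j} {i | G.Adj i j} := by
  refine condDistrib_ae_eq_of_common_approx (measurable_domRestrict _) (measurable_domRestrict _)
    (law_absolutelyContinuous _ _ (hpos q)) (law_absolutelyContinuous _ _ (hpos 0))
    fun B hB ε hε => ?_
  obtain ⟨H, hHm, hH1, hH⟩ := h.exists_test hG j hB hε
  have hgd : ∀ g : ({i | G.Adj i j} → ℝ) → ℝ, DependsOn
      (fun x : V → ℝ => g (Set.domRestrict (π := fun _ => ℝ) {i | G.Adj i j} x))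
      {i | ¬ Relation.ReflTransGen G.Adj j i} :=
    fun g => dependsOn_comp_domRestrict (hG.parents_subset j) g
  exact ⟨H, hHm, hH1, fun g hg hg1 =>
    ⟨hH 0 (.inl rfl) _ (hg.comp (measurable_domRestrict _)) (fun x => hg1 _) (hgd g),
     hH q (.inr hj) _ (hg.comp (measurable_domRestrict _)) (fun x => hg1 _) (hgd g)⟩⟩

theorem pos_of_mem_markovFamilies {I : InterventionFamily V K} {p : Fin (K + 1) → JointDensity V}
    (hp : p ∈ markovFamilies I G) (q : Fin (K + 1)) : ∀ᵐ x, 0 < (p q).toFun x := by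
  classical
  obtain ⟨c, hc, hp⟩ := hp
  filter_upwards [hp q] with x hx
  rw [hx]
  exact Finset.prod_pos fun j _ => (hc _ j).pos _ _

/-- A faithful ground truth that is approximable by a candidate has all separations which the
candidate asserts. -/
theorem IsApproximable.separates {Gs : Digraph V} {I Is : InterventionFamily V K}
    {p : Fin (K + 1) → JointDensity V} (h : IsApproximable I G p) (hG : IsDAG G)
    (hpos : ∀ q, ∀ᵐ x, 0 < (p q).toFun x) (hfaith : IFaithful p Gs Is) :
    Separates G I Gs Is := by
  refine ⟨fun a b hab hadj hd => ?_, fun j k hj => ?_⟩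
  · by_contra hn
    refine hfaith.indep {a} {b} {i | G.Adj i b} (by simpa using hab)
      (by simpa using hadj) (by simpa using hG.irrefl b) hn (h.condIndepVars hG hab hd)
  · by_contra hn
    exact hfaith.invariance {j} {i | G.Adj i j} k (by simpa using hG.irrefl j) hn
      (h.sameConditional hG hpos hj)

end Approximation

/-! ### The expected log-likelihood -/

section Score

theorem exists_coe_of_ne_bot {ι : Type*} {E : ι → EReal} {s : Finset ι}
    (hE : ∀ i, E i = ⊥ ∨ ∃ e : ℝ, E i = e) (hs : ∑ i ∈ s, E i ≠ ⊥) :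
    ∃ e : ι → ℝ, (∀ i ∈ s, E i = e i) ∧ ∑ i ∈ s, E i = ((∑ i ∈ s, e i : ℝ) : EReal) := by
  classical
  induction s using Finset.induction_on with
  | empty => exact ⟨fun _ => 0, by simp, by simp⟩
  | insert a s ha ih =>
    rw [Finset.sum_insert ha, EReal.add_ne_bot_iff] at hs
    obtain ⟨e, he, hsum⟩ := ih hs.2
    obtain ⟨r, hr⟩ := (hE a).resolve_left hs.1
    have hne : ∀ i ∈ s, (if i = a then r else e i) = e i := fun i hi =>
      if_neg (by rintro rfl; exact ha hi)
    refine ⟨fun i => if i = a then r else e i, fun i hi => ?_, ?_⟩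
    · rcases Finset.mem_insert.1 hi with rfl | hi
      · simpa using hr
      · simp only [hne i hi]
        exact he i hi
    · rw [Finset.sum_insert ha, Finset.sum_insert ha, hsum, hr, Finset.sum_congr rfl hne, if_pos rfl,
        EReal.coe_add]

variable {V : Type*}

theorem expectation_eq_integral {μ : Measure (V → ℝ)} {g : (V → ℝ) → ℝ} (hg : Integrable g μ) :
    expectation μ g = ((∫ x, g x ∂μ : ℝ) : EReal) := by
  have h1 : ∫⁻ x, ENNReal.ofReal (g x) ∂μ ≠ ⊤ := hg.lintegral_lt_top.ne
  have h2 : ∫⁻ x, ENNReal.ofReal (-g x) ∂μ ≠ ⊤ := hg.neg.lintegral_lt_top.ne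
  rw [expectation, integral_eq_lintegral_pos_part_sub_lintegral_neg_part hg, EReal.coe_sub,
    EReal.coe_ennreal_toReal h1, EReal.coe_ennreal_toReal h2]

theorem expectation_congr {μ : Measure (V → ℝ)} {g g' : (V → ℝ) → ℝ} (h : g =ᵐ[μ] g') :
    expectation μ g = expectation μ g' := by
  have h1 : ∫⁻ x, ENNReal.ofReal (g x) ∂μ = ∫⁻ x, ENNReal.ofReal (g' x) ∂μ :=
    lintegral_congr_ae (h.mono fun x hx => by simp only [hx])
  have h2 : ∫⁻ x, ENNReal.ofReal (-g x) ∂μ = ∫⁻ x, ENNReal.ofReal (-g' x) ∂μ :=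
    lintegral_congr_ae (h.mono fun x hx => by simp only [hx])
  rw [expectation, expectation, h1, h2]

variable [Fintype V]

theorem JointDensity.integrable_law_iff (p : JointDensity V) (g : (V → ℝ) → ℝ) :
    Integrable g p.law ↔ Integrable fun x => p.toFun x * g x := by
  rw [JointDensity.law, integrable_withDensity_iff_integrable_smul' p.measurable.ennreal_ofReal
    (ae_of_all _ fun _ => ENNReal.ofReal_lt_top)]
  simp_rw [ENNReal.toReal_ofReal (p.nonneg _), smul_eq_mul]

theorem JointDensity.integral_eq_one (p : JointDensity V) : ∫ x, p.toFun x = 1 := by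
  rw [integral_eq_lintegral_of_nonneg_ae (ae_of_all _ p.nonneg)
    p.measurable.aestronglyMeasurable, p.lintegral_eq_one, ENNReal.toReal_one]

/-- The negative differential entropy `∫ p log p`. -/
noncomputable def JointDensity.negEntropy (p : JointDensity V) : ℝ :=
  ∫ x, p.toFun x * Real.log (p.toFun x)

theorem JointDensity.expectation_log_self (p : JointDensity V) (hent : p.HasFiniteEntropy) :
    expectation p.law (fun x => Real.log (p.toFun x)) = (p.negEntropy : EReal) := by
  rw [expectation_eq_integral ((p.integrable_law_iff _).2 hent), p.integral_law]
  rfl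

/-- The pointwise form of a Pinsker type inequality: the `L¹` distance is bounded by the
Kullback-Leibler divergence, by way of the Hellinger distance. -/
theorem abs_sub_le_of_log {a b t : ℝ} (ha : 0 < a) (hb : 0 < b) (ht : 0 < t) :
    |a - b| ≤ (a * Real.log a - a * Real.log b + b - a) / (2 * t) + t * (a + b) := by
  obtain ⟨u, hu, rfl⟩ : ∃ u, 0 < u ∧ a = u ^ 2 :=
    ⟨√a, Real.sqrt_pos.2 ha, (Real.sq_sqrt ha.le).symm⟩
  obtain ⟨v, hv, rfl⟩ : ∃ v, 0 < v ∧ b = v ^ 2 :=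
    ⟨√b, Real.sqrt_pos.2 hb, (Real.sq_sqrt hb.le).symm⟩
  have hlog : Real.log v - Real.log u ≤ v / u - 1 := by
    rw [← Real.log_div hv.ne' hu.ne']
    exact Real.log_le_sub_one_of_pos (div_pos hv hu)
  have hkl : (u - v) ^ 2 ≤ u ^ 2 * Real.log (u ^ 2) - u ^ 2 * Real.log (v ^ 2) + v ^ 2 - u ^ 2 := by
    rw [Real.log_pow, Real.log_pow]
    have h1 : u ^ 2 * (Real.log v - Real.log u) ≤ u ^ 2 * (v / u - 1) :=
      mul_le_mul_of_nonneg_left hlog (sq_nonneg u)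
    have h2 : u ^ 2 * (v / u - 1) = u * v - u ^ 2 := by
      field_simp
    rw [h2] at h1
    push_cast
    nlinarith
  refine le_trans ?_ (add_le_add_left (div_le_div_of_nonneg_right hkl (by positivity)) _)
  have h3 : |u ^ 2 - v ^ 2| = |u - v| * (u + v) := by
    rw [show u ^ 2 - v ^ 2 = (u - v) * (u + v) by ring, abs_mul, abs_of_pos (add_pos hu hv)]
  rw [h3, ← sub_le_iff_le_add, le_div_iff₀ (by positivity), ← sq_abs (u - v)]
  nlinarith [sq_nonneg (|u - v| - t * (u + v)), mul_nonneg (sq_nonneg t) (sq_nonneg (u - v))]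

/-- The expected log-likelihood of a density `f` under `p` is either `-∞` or a real number. It is at
most the one of `p` itself, and close to it only if `f` is close to `p` in `L¹`. -/
theorem expectation_log_eq_bot_or (p f : JointDensity V) (hp : ∀ᵐ x, 0 < p.toFun x)
    (hf : ∀ x, 0 < f.toFun x) (hent : p.HasFiniteEntropy) :
    expectation p.law (fun x => Real.log (f.toFun x)) = ⊥ ∨
      ∃ e : ℝ, expectation p.law (fun x => Real.log (f.toFun x)) = e ∧ e ≤ p.negEntropy ∧
        ∀ t, 0 < t → ∫ x, |p.toFun x - f.toFun x| ≤ (p.negEntropy - e) / (2 * t) + 2 * t := by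
  set g : (V → ℝ) → ℝ := fun x => Real.log (f.toFun x) with hg
  have hgm : Measurable g := Real.measurable_log.comp f.measurable
  -- the positive part of `log f` is integrable under `p`
  have hpos : ∫⁻ x, ENNReal.ofReal (g x) ∂p.law ≠ ⊤ := by
    have hI : Integrable fun x => |p.toFun x * Real.log (p.toFun x)| + f.toFun x :=
      hent.abs.add f.integrable
    have hle : ∫⁻ x, ENNReal.ofReal (g x) ∂p.law ≤
        ∫⁻ x, ENNReal.ofReal (|p.toFun x * Real.log (p.toFun x)| + f.toFun x) := by
      rw [JointDensity.law, lintegral_withDensity_eq_lintegral_mul _ p.measurable.ennreal_ofReal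
        hgm.ennreal_ofReal]
      refine lintegral_mono_ae ?_
      filter_upwards [hp] with x hx
      rw [Pi.mul_apply, ← ENNReal.ofReal_mul hx.le]
      refine ENNReal.ofReal_le_ofReal ?_
      have h1 : g x - Real.log (p.toFun x) ≤ f.toFun x / p.toFun x - 1 := by
        rw [hg, ← Real.log_div (hf x).ne' hx.ne']
        exact Real.log_le_sub_one_of_pos (div_pos (hf x) hx)
      have h2 := mul_le_mul_of_nonneg_left h1 hx.le
      rw [mul_sub, mul_sub, mul_div_cancel₀ _ hx.ne', mul_one] at h2
      linarith [le_abs_self (p.toFun x * Real.log (p.toFun x))]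
    exact (hle.trans_lt hI.lintegral_lt_top).ne
  by_cases hneg : ∫⁻ x, ENNReal.ofReal (-g x) ∂p.law = ⊤
  · left
    rw [expectation, hneg, EReal.coe_ennreal_top, EReal.sub_top]
  · right
    have hint : Integrable g p.law := by
      refine ⟨hgm.aestronglyMeasurable, ?_⟩
      have hadd : ∀ x, ‖g x‖ₑ = ENNReal.ofReal (g x) + ENNReal.ofReal (-g x) := fun x => by
        rw [Real.enorm_eq_ofReal_abs]
        rcases le_total 0 (g x) with h | h
        · rw [abs_of_nonneg h, ENNReal.ofReal_of_nonpos (neg_nonpos.2 h), add_zero]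
        · rw [abs_of_nonpos h, ENNReal.ofReal_of_nonpos h, zero_add]
      rw [HasFiniteIntegral]
      simp_rw [hadd]
      rw [lintegral_add_left hgm.ennreal_ofReal]
      exact ENNReal.add_lt_top.2 ⟨hpos.lt_top, lt_top_iff_ne_top.2 hneg⟩
    have hint' := (p.integrable_law_iff g).1 hint
    refine ⟨∫ x, g x ∂p.law, expectation_eq_integral hint, ?_⟩
    have hD : Integrable fun x => p.toFun x * Real.log (p.toFun x) - p.toFun x * g x + f.toFun x -
        p.toFun x := ((hent.sub hint').add f.integrable).sub p.integrable
    have hDint : ∫ x, (p.toFun x * Real.log (p.toFun x) - p.toFun x * g x + f.toFun x -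
        p.toFun x) = p.negEntropy - ∫ x, g x ∂p.law := by
      have e1 := integral_sub ((hent.sub hint').add f.integrable) p.integrable
      have e2 := integral_add (hent.sub hint') f.integrable
      have e3 := integral_sub hent hint'
      simp only [Pi.add_apply, Pi.sub_apply] at e1 e2 e3
      rw [e1, e2, e3, f.integral_eq_one, p.integral_eq_one, p.integral_law,
        JointDensity.negEntropy]
      ring
    have hmain : ∀ t, 0 < t →
        ∫ x, |p.toFun x - f.toFun x| ≤ (p.negEntropy - ∫ x, g x ∂p.law) / (2 * t) + 2 * t := by
      intro t ht
      have hR := (hD.div_const (2 * t)).add ((p.integrable.add f.integrable).const_mul t)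
      have hle := integral_mono_ae (p.integrable.sub f.integrable).abs hR (by
        filter_upwards [hp] with x hx
        exact abs_sub_le_of_log hx (hf x) ht)
      refine hle.trans_eq ?_
      have e1 := integral_add (hD.div_const (2 * t))
        ((p.integrable.add f.integrable).const_mul t)
      simp only [Pi.add_apply] at e1 ⊢
      rw [e1, integral_div, hDint, integral_const_mul, integral_add p.integrable f.integrable,
        p.integral_eq_one, f.integral_eq_one]
      ring
    refine ⟨?_, hmain⟩
    rw [← sub_nonneg, ← hDint]
    refine integral_nonneg_of_ae ?_
    filter_upwards [hp] with x hx
    have h1 : g x - Real.log (p.toFun x) ≤ f.toFun x / p.toFun x - 1 := by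
      rw [hg, ← Real.log_div (hf x).ne' hx.ne']
      exact Real.log_le_sub_one_of_pos (div_pos (hf x) hx)
    have h2 := mul_le_mul_of_nonneg_left h1 hx.le
    rw [mul_sub, mul_sub, mul_div_cancel₀ _ hx.ne', mul_one] at h2
    simp only [Pi.zero_apply]
    linarith

/-! ### The densities of the parametric model -/

variable {Θ : Type*} [MeasurableSpace Θ] {Φ : V → Type*} {K : ℕ}

/-- The model density is positive for every graph that is a DAG, all targets and all weights. -/
def DensityModel.IsPositive (m : DensityModel V Θ Φ) (K : ℕ) : Prop :=
  ∀ G : Digraph V, IsDAG G → ∀ (I : InterventionFamily V K)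
    (φ : Fin (K + 1) → ∀ j, Φ j) (q : Fin (K + 1)) (x : V → ℝ), 0 < m.joint G I φ q x

variable (m : DensityModel V Θ Φ) {G : Digraph V} {I : InterventionFamily V K}

/-- The conditional density of the node `j` with weights `w`. -/
noncomputable def DensityModel.cond (G : Digraph V) (j : V) (w : Φ j) (x : V → ℝ) (y : ℝ) : ℝ :=
  m.dens (m.net j w (mask G j x)) y

variable {m}

theorem DensityModel.IsPositive.isCondDensity (hm : m.IsPositive K) (hG : IsDAG G) (j : V)
    (w : ∀ j, Φ j) : IsCondDensity G j (m.cond G j (w j)) := by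
  classical
  have hmask : Measurable (mask G j) := by
    refine measurable_pi_lambda _ fun i => ?_
    by_cases h : G.Adj i j
    · simpa [mask, h] using measurable_pi_apply i
    · simp [mask, h]
  have hpar : ∀ x x' : V → ℝ, (∀ i, G.Adj i j → x i = x' i) → mask G j x = mask G j x' := by
    intro x x' h
    funext i
    by_cases hi : G.Adj i j
    · simp [mask, hi, h i hi]
    · simp [mask, hi]
  refine ⟨m.measurable_dens.comp ((((m.measurable_net j (w j)).comp hmask).comp
    measurable_fst).prodMk measurable_snd), fun x y => ?_, fun x => m.lintegral_dens _,
    fun x x' h => ?_⟩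
  · -- all factors of the joint density at the point with `j`-th coordinate `y` are nonzero
    have h1 := hm G hG (fun _ => ∅) (fun _ => w) 0 (Function.update x j y)
    rw [DensityModel.joint] at h1
    have h2 := Finset.prod_ne_zero_iff.1 h1.ne' j (Finset.mem_univ j)
    rw [Function.update_self, hpar (Function.update x j y) x fun i hi =>
      Function.update_of_ne (hG.ne hi) _ _] at h2
    exact lt_of_le_of_ne (m.dens_nonneg _ _) h2.symm
  · funext y
    simp only [DensityModel.cond, hpar x x' h]

/-- The density of regime `q` as a joint density. -/
noncomputable def regimeJointDensity (hG : IsDAG G) (I : InterventionFamily V K)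
    {c : Fin (K + 1) → V → (V → ℝ) → ℝ → ℝ} (hc : ∀ q j, IsCondDensity G j (c q j))
    (q : Fin (K + 1)) : JointDensity V where
  toFun := regimeDensity I c q
  measurable := measurable_productDensity fun j => hc _ j
  nonneg x := (productDensity_pos (fun j => hc _ j) x).le
  lintegral_eq_one := lintegral_productDensity hG fun j => hc _ j

variable {p : Fin (K + 1) → JointDensity V}

/-- The expected log-likelihood is bounded by the negative entropy, with a gap if the ground truth
is not approximable. -/
theorem DensityModel.IsPositive.iSup_le (hm : m.IsPositive K) (hG : IsDAG G)
    (hp : ∀ q, ∀ᵐ x, 0 < (p q).toFun x) (hent : ∀ q, (p q).HasFiniteEntropy) :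
    (⨆ φ : Fin (K + 1) → ∀ j, Φ j,
      ∑ q, expectation (p q).law (fun x => Real.log (m.joint G I φ q x))) ≤
        ((∑ q, (p q).negEntropy : ℝ) : EReal) ∧
    (¬ IsApproximable I G p → ∃ δ : ℝ, 0 < δ ∧ (⨆ φ : Fin (K + 1) → ∀ j, Φ j,
      ∑ q, expectation (p q).law (fun x => Real.log (m.joint G I φ q x))) ≤
        ((∑ q, (p q).negEntropy - δ : ℝ) : EReal)) := by
  have hc : ∀ (φ : Fin (K + 1) → ∀ j, Φ j) (q : Fin (K + 1)) (j : V),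
      IsCondDensity G j (m.cond G j (φ q j)) := fun φ q j => hm.isCondDensity hG j (φ q)
  have key := fun (φ : Fin (K + 1) → ∀ j, Φ j) (q : Fin (K + 1)) =>
    expectation_log_eq_bot_or (p q) (regimeJointDensity hG I (hc φ) q) (hp q)
      (fun x => productDensity_pos (fun j => hc φ _ j) x) (hent q)
  have hbot : ∀ (φ : Fin (K + 1) → ∀ j, Φ j) (q : Fin (K + 1)),
      expectation (p q).law (fun x => Real.log (m.joint G I φ q x)) = ⊥ ∨
      ∃ e : ℝ, expectation (p q).law (fun x => Real.log (m.joint G I φ q x)) = e := fun φ q =>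
    (key φ q).imp id fun ⟨e, he, _⟩ => ⟨e, he⟩
  -- for weights with finite likelihood the divergences of all regimes are nonnegative and finite
  have hreal : ∀ φ : Fin (K + 1) → ∀ j, Φ j,
      ∑ q, expectation (p q).law (fun x => Real.log (m.joint G I φ q x)) ≠ ⊥ →
      ∃ e : Fin (K + 1) → ℝ,
        ∑ q, expectation (p q).law (fun x => Real.log (m.joint G I φ q x)) =
          ((∑ q, e q : ℝ) : EReal) ∧
        ∀ q, e q ≤ (p q).negEntropy ∧ ∀ t, 0 < t → ∫ x, |(p q).toFun x -
          regimeDensity I (fun q j => m.cond G j (φ q j)) q x| ≤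
            ((p q).negEntropy - e q) / (2 * t) + 2 * t := by
    intro φ hne
    obtain ⟨e, he, hsum⟩ := exists_coe_of_ne_bot (hbot φ) hne
    refine ⟨e, hsum, fun q => ?_⟩
    rcases key φ q with h | ⟨e', he', hle, ht⟩
    · exact absurd (h.symm.trans (he q (Finset.mem_univ q))) (EReal.bot_ne_coe _)
    · have : e q = e' := EReal.coe_injective ((he q (Finset.mem_univ q)).symm.trans he')
      rw [this]
      exact ⟨hle, ht⟩
  refine ⟨_root_.iSup_le fun φ => ?_, fun hna => ?_⟩
  · by_cases hne : ∑ q, expectation (p q).law (fun x => Real.log (m.joint G I φ q x)) = ⊥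
    · rw [hne]
      exact bot_le
    · obtain ⟨e, hsum, hq⟩ := hreal φ hne
      rw [hsum, EReal.coe_le_coe_iff]
      exact Finset.sum_le_sum fun q _ => (hq q).1
  · simp only [IsApproximable, not_forall, not_exists, not_and, not_le] at hna
    obtain ⟨ε, hε, hna⟩ := hna
    -- with `t = ε / 4`, a divergence of at most `ε² / 4` gives a distance of at most `ε`
    refine ⟨ε ^ 2 / 4, by positivity, _root_.iSup_le fun φ => ?_⟩
    by_cases hne : ∑ q, expectation (p q).law (fun x => Real.log (m.joint G I φ q x)) = ⊥
    · rw [hne]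
      exact bot_le
    · obtain ⟨e, hsum, hq⟩ := hreal φ hne
      rw [hsum, EReal.coe_le_coe_iff]
      obtain ⟨q, hlt⟩ := hna _ (hc φ)
      have h1 := (hq q).2 (ε / 4) (by positivity)
      have h2 : ε < ((p q).negEntropy - e q) / (2 * (ε / 4)) + 2 * (ε / 4) := hlt.trans_le h1
      have h3 : ε ^ 2 / 4 ≤ (p q).negEntropy - e q := by
        rw [← sub_lt_iff_lt_add, lt_div_iff₀ (by positivity)] at h2
        nlinarith
      have h4 : (p q).negEntropy - e q ≤ ∑ q, ((p q).negEntropy - e q) :=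
        Finset.single_le_sum (f := fun q => (p q).negEntropy - e q)
          (fun q _ => sub_nonneg.2 (hq q).1) (Finset.mem_univ q)
      rw [Finset.sum_sub_distrib] at h4
      linarith

/-- A model that can represent the ground truth attains the bound. -/
theorem DensityModel.le_iSup_of_capacity (hent : ∀ q, (p q).HasFiniteEntropy)
    (hcap : ∃ φ : Fin (K + 1) → ∀ j, Φ j, ∀ q, (p q).toFun =ᵐ[volume] m.joint G I φ q) :
    ((∑ q, (p q).negEntropy : ℝ) : EReal) ≤ ⨆ φ : Fin (K + 1) → ∀ j, Φ j,
      ∑ q, expectation (p q).law (fun x => Real.log (m.joint G I φ q x)) := by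
  obtain ⟨φ, hφ⟩ := hcap
  have hE : ∀ q, expectation (p q).law (fun x => Real.log (m.joint G I φ q x)) =
      ((p q).negEntropy : EReal) := fun q => by
    rw [← (p q).expectation_log_self (hent q)]
    refine expectation_congr ((withDensity_absolutelyContinuous _ _).ae_le ?_)
    filter_upwards [hφ q] with x hx
    rw [hx]
  refine le_trans (le_of_eq ?_) (le_iSup _ φ)
  obtain ⟨e, he, hsum⟩ := exists_coe_of_ne_bot (s := Finset.univ)
    (E := fun q => ((p q).negEntropy : EReal)) (fun q => .inr ⟨_, rfl⟩) (by
      have : ∀ s : Finset (Fin (K + 1)), ∑ q ∈ s, ((p q).negEntropy : EReal) ≠ ⊥ := fun s => by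
        classical
        induction s using Finset.induction_on with
        | empty => simp
        | insert a s ha ih =>
          rw [Finset.sum_insert ha]
          exact EReal.add_ne_bot_iff.2 ⟨EReal.coe_ne_bot _, ih⟩
      exact this _)
  simp_rw [hE]
  rw [hsum]
  congr 1
  exact Finset.sum_congr rfl fun q hq => EReal.coe_injective (he q hq)

end Score

end TemporalCausal

/-! ### Maximizers of the score -/

open TemporalCausal
theorem mainTheorem1 {d p K : ℕ}
    {Θ : Type*} [MeasurableSpace Θ] {Φ : Node d p → Type*}
    (m : DensityModel (Node d p) Θ Φ)
    -- the ground truth: DAG, interventional family, and densities that factorize accordingly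
    (Gs : Digraph (Node d p)) (hGs : IsDAG Gs)
    (Is : InterventionFamily (Node d p) K) (hIs : Is 0 = ∅)
    (P : Fin (K + 1) → JointDensity (Node d p)) (hP : P ∈ markovFamilies Is Gs)
    -- the model can represent the ground truth
    (hcap : ∃ φ : Fin (K + 1) → ∀ j, Φ j, ∀ q, (P q).toFun =ᵐ[volume] m.joint Gs Is φ q)
    (hfaith : IFaithful P Gs Is)
    -- the density model is strictly positive
    (hpos : ∀ G : Digraph (Node d p), IsDAG G → ∀ (I : InterventionFamily (Node d p) K)
      (φ : Fin (K + 1) → ∀ j, Φ j) (q : Fin (K + 1)) (x : Node d p → ℝ), 0 < m.joint G I φ q x)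
    (hent : ∀ q, (P q).HasFiniteEntropy) :
    ∃ lam0 : ℝ, 0 < lam0 ∧ ∀ lam lamR : ℝ, 0 < lam → lam < lam0 → 0 < lamR → lamR < lam0 →
      -- any search space of DAGs and interventional families which contains the ground truth,
      -- such as all DAGs and all families, or only the DAGs without edges from a later to an
      -- earlier time and the families with targets among the contemporaneous variables
      ∀ S : Set (Digraph (Node d p) × InterventionFamily (Node d p) K),
        (∀ s ∈ S, IsDAG s.1) → (Gs, Is) ∈ S →
        ∀ (G : Digraph (Node d p)) (I : InterventionFamily (Node d p) K), (G, I) ∈ S →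
          (∀ s ∈ S, score m P lam lamR s.1 s.2 ≤ score m P lam lamR G I) →
          IMarkovEquiv Is G Gs ∧ I = Is := by
  classical
  have hm : m.IsPositive K := hpos
  have hp := pos_of_mem_markovFamilies hP
  -- one gap that works for the finitely many candidates that do not approximate the ground truth
  have hgap : ∀ s : Digraph (Node d p) × InterventionFamily (Node d p) K, ∃ δ : ℝ, 0 < δ ∧
      (IsDAG s.1 → ¬ IsApproximable s.2 s.1 P → (⨆ φ : Fin (K + 1) → ∀ j, Φ j,
        ∑ q, expectation (P q).law (fun x => Real.log (m.joint s.1 s.2 φ q x))) ≤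
          ((∑ q, (P q).negEntropy - δ : ℝ) : EReal)) := by
    intro s
    by_cases h : IsDAG s.1 ∧ ¬ IsApproximable s.2 s.1 P
    · obtain ⟨δ, hδ, hle⟩ := (hm.iSup_le (I := s.2) h.1 hp hent).2 h.2
      exact ⟨δ, hδ, fun _ _ => hle⟩
    · exact ⟨1, one_pos, fun h1 h2 => absurd ⟨h1, h2⟩ h⟩
  choose δ hδ hgap using hgap
  have : Nonempty (Digraph (Node d p) × InterventionFamily (Node d p) K) := ⟨(Gs, Is)⟩
  obtain ⟨s₀, hs₀⟩ := Finite.exists_min δ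
  set n : ℝ := (edgeCount Gs : ℝ) + targetCount Is with hn
  have hn0 : 0 ≤ n := by positivity
  refine ⟨δ s₀ / (n + 1), div_pos (hδ s₀) (by linarith), ?_⟩
  intro lam lamR hlam hlam' hlamR hlamR' S hS hGsS G I hGI hmax
  have hG : IsDAG G := hS _ hGI
  have hscore := hmax _ hGsS
  -- a bound of the likelihood term of the candidate turns into an inequality of real numbers
  have hcompare : ∀ b : ℝ, (⨆ φ : Fin (K + 1) → ∀ j, Φ j,
      ∑ q, expectation (P q).law (fun x => Real.log (m.joint G I φ q x))) ≤ (b : EReal) →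
      ∑ q, (P q).negEntropy - lam * edgeCount Gs - lamR * targetCount Is ≤
        b - lam * edgeCount G - lamR * targetCount I := by
    intro b hb
    have h1 : ((∑ q, (P q).negEntropy - lam * edgeCount Gs - lamR * targetCount Is : ℝ) : EReal) ≤
        score m P lam lamR Gs Is := by
      rw [EReal.coe_sub, EReal.coe_sub, score]
      exact EReal.sub_le_sub (EReal.sub_le_sub
        (DensityModel.le_iSup_of_capacity hent hcap) le_rfl) le_rfl
    have h2 : score m P lam lamR G I ≤
        ((b - lam * edgeCount G - lamR * targetCount I : ℝ) : EReal) := by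
      rw [EReal.coe_sub, EReal.coe_sub, score]
      exact EReal.sub_le_sub (EReal.sub_le_sub hb le_rfl) le_rfl
    exact EReal.coe_le_coe_iff.1 (h1.trans (hscore.trans h2))
  have happ : IsApproximable I G P := by
    by_contra hna
    have h1 := hcompare _ (hgap (G, I) hG hna)
    have h2 : lam * edgeCount Gs ≤ δ s₀ / (n + 1) * edgeCount Gs :=
      mul_le_mul_of_nonneg_right hlam'.le (Nat.cast_nonneg _)
    have h3 : lamR * targetCount Is ≤ δ s₀ / (n + 1) * targetCount Is :=
      mul_le_mul_of_nonneg_right hlamR'.le (Nat.cast_nonneg _)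
    have h4 : δ s₀ / (n + 1) * n < δ s₀ := by
      rw [div_mul_eq_mul_div, div_lt_iff₀ (by linarith)]
      nlinarith [hδ s₀]
    have h5 : 0 ≤ lam * edgeCount G := by positivity
    have h6 : 0 ≤ lamR * targetCount I := by positivity
    have h7 := hs₀ (G, I)
    rw [hn, mul_add] at h4
    linarith
  have hsep := happ.separates hG hp hfaith
  have hle := hcompare _ (hm.iSup_le (I := I) hG hp hent).1
  have hedge : (edgeCount Gs : ℝ) ≤ edgeCount G := by exact_mod_cast hsep.edgeCount_le hG hGs
  have htarget : (targetCount Is : ℝ) ≤ targetCount I := by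
    exact_mod_cast Finset.sum_le_sum fun q _ => Finset.card_le_card (hsep.subset hIs q)
  have h1 : edgeCount G ≤ edgeCount Gs := by
    have : (edgeCount G : ℝ) ≤ edgeCount Gs := by
      by_contra hlt
      nlinarith
    exact_mod_cast this
  have h2 : targetCount I ≤ targetCount Is := by
    have : (targetCount I : ℝ) ≤ targetCount Is := by
      by_contra hlt
      nlinarith
    exact_mod_cast this
  obtain ⟨hI, hequiv⟩ := hsep.graphEquiv hG hGs hIs h1 h2
  exact ⟨hequiv.iMarkovEquiv hG hGs, hI⟩
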